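/- \textbf{Setting.} The Wait-Free Eras (WFE) memory reclamation scheme is run by $n$ threads over sequentially consistent shared memory with atomic reads and writes, fetch-and-add (F\&A), and compare-and-swap on adjacent pairs of words (WCAS); $\mathit{max\_hes}$ is the number of reservations per thread that the application can use. The shared variables are the clock $\mathit{global\_era}$, the counters $\mathit{counter\_start}$ and $\mathit{counter\_end}$, for each thread $i$ an array $\mathit{reservations}[i][0..\mathit{max\_hes}+1]$ of pairs $\{A=\text{era},\,B=\text{tag}\}$ (the last two entries being internal to helpers), and for each thread $i$ and $j<\mathit{max\_hes}$ a record $\mathit{state}[i][j]$ with fields $\mathit{result}$ (a pair), $\mathit{era}$ and $\mathit{pointer}$. Eras, tags and counters do not overflow. A single allocator call is one step. \begin{itemize} \item $\mathrm{get\_protected}(\mathit{ptr},j,\mathit{parent})$ by thread $i$ tries a fixed number of times to read $*\mathit{ptr}$ while the era it has published in $\mathit{reservations}[i][j].A$ agrees with $\mathit{global\_era}$. If this fails, it increments $\mathit{counter\_start}$, stores $\mathit{ptr}$ and the allocation era of $\mathit{parent}$ ($\infty$ if there is no parent) in $\mathit{state}[i][j]$, and sets $\mathit{state}[i][j].\mathit{result}$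 to $\{\mathbf{invptr},\mathit{tag}\}$ with $\mathit{tag}=\mathit{reservations}[i][j].B$. It then repeats the attempt; on agreement of the eras it tries to cancel the request by a WCAS of $\mathit{result}$ to $\{\mathbf{nullptr},\infty\}$, and otherwise it updates $\mathit{reservations}[i][j]$ from $\{\mathit{prev},\mathit{tag}\}$ to $\{\mathit{new},\mathit{tag}\}$ by WCAS; the loop ends when the pointer in $\mathit{result}$ is no longer $\mathbf{invptr}$, and then the era from $\mathit{result}$ and $\mathit{tag}+1$ are written to $\mathit{reservations}[i][j]$ (after a cancellation only $\mathit{tag}+1$ is written). At the end it increments $\mathit{counter\_end}$. \item $\mathrm{increment\_era}()$ reads $\mathit{counter\_end}$ and then $\mathit{counter\_start}$. If they differ, it calls $\mathrm{help\_thread}(i,j)$ for every $(i,j)$ for which it finds $\mathit{state}[i][j].\mathit{result}.A=\mathbf{invptr}$. Finally it increments $\mathit{global\_era}$. \item $\mathrm{help\_thread}(i,j)$ reads $\mathit{state}[i][j].\mathit{result}$ and returns unless its pointer is $\mathbf{invptr}$; it publishes $\mathit{state}[i][j].\mathit{era}$ in its first special reservation, reads the pointer $\mathit{ptr}$ from $\mathit{state}[i][j]$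 and $\mathit{tag}=\mathit{reservations}[i][j].B$, and gives up if $\mathit{tag}$ differs from the one in $\mathit{result}$. In the \emph{helping loop} it publishes the last read era in its second special reservation, reads $*\mathit{ptr}$ and then $\mathit{global\_era}$. If the era is unchanged it tries to replace $\{\mathbf{invptr},\mathit{tag}\}$ in $\mathit{state}[i][j].\mathit{result}$ by $\{*\mathit{ptr},\text{era}\}$ by WCAS and leaves the loop; otherwise it repeats as long as $\mathit{state}[i][j].\mathit{result}=\{\mathbf{invptr},\mathit{tag}\}$. If that WCAS succeeded, it runs the \emph{hand-over loop}: read $\mathit{reservations}[i][j]$, leave the loop if its tag is not $\mathit{tag}$, otherwise try to change it to $\{\text{era},\mathit{tag}+1\}$ by WCAS, and repeat if this WCAS fails. At the end the two special reservations are reset to $\infty$. \item $\mathrm{alloc\_block}()$ calls $\mathrm{increment\_era}()$ once every $\mathit{era\_freq}$ calls of the thread, then obtains a block from the allocator, sets its allocation era to $\mathit{global\_era}$ and returns it. \item $\mathrm{retire}()$ records the current era as the block's retire era, appends the block to the thread's list, and once every $\mathit{cleanup\_freq}$ calls runs $\mathrm{increment\_era}()$ (if $\mathit{global\_era}$ still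 equals that retire era) followed by $\mathrm{cleanup}()$, which scans the reservations and frees the blocks found unprotected; $\mathrm{clear}()$ resets the era of the thread's application reservations to $\infty$. \end{itemize} Programs are well-behaved: each thread executes arbitrary application code and calls these operations one at a time, with application indices $j<\mathit{max\_hes}$, and $\mathbf{invptr}$ is never stored in application memory. The schedule is arbitrary; no fairness is assumed. \textbf{Theorem.} $\mathrm{alloc\_block}()$ is wait-free bounded: there is a function $B(n,\mathit{max\_hes})$ such that in every execution, for every call of $\mathrm{alloc\_block}()$ by a thread, the thread is never blocked during the call, and the call has returned a block once the thread has taken $B(n,\mathit{max\_hes})$ steps of its own after the invocation, whatever the other threads do. Moreover, in every call of $\mathrm{help\_thread}()$ the helping loop runs for at most $n$ iterations, and the hand-over loop runs for at most $2$ iterations with the tag intact (that is, it executes its WCAS at most twice). -/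

import Mathlib

namespace WFE

/-- Eras are natural numbers; `⊤` is the era `∞` (no reservation). Tags share the second
component of a `result` pair with eras, so they are coerced to `Era` there. -/
abbrev Era := WithTop ℕ

/-- Pointer values: `nullptr`, the reserved value `invptr`, and pointers to blocks. -/
inductive Ptr
  | null
  | inv
  | blk (b : ℕ)
  deriving DecidableEq

/-- Number of threads, number of application-level reservations per thread, number of attempts
on the fast path of `get_protected`, and the periods with which `alloc_block` calls
`increment_era` and `retire` calls `cleanup`. -/
structure Params where
  threads : ℕ
  maxHes : ℕ
  maxAttempts : ℕ
  eraFreq : ℕ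
  cleanupFreq : ℕ

variable {p : Params}

/-- The slow-path state of one reservation. A pending request is `result = (invptr, tag)`. -/
structure SlotState where
  result : Ptr × Era
  era : Era
  pointer : ℕ

/-- The reservation with index `j` available to the application. -/
def normal (j : Fin p.maxHes) : Fin (p.maxHes + 2) := Fin.castAdd 2 j

/-- First special reservation, `max_hes`: a helper protects the parent block with it. -/
def special1 : Fin (p.maxHes + 2) := Fin.natAdd p.maxHes 0

/-- Second special reservation, `max_hes + 1`: a helper protects the dereferenced block with it. -/
def special2 : Fin (p.maxHes + 2) := Fin.natAdd p.maxHes 1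

/-- Control states (with live local variables) of `get_protected(a, j, parent)`; each is named
after the atomic action executed next. -/
inductive GetPc
  /-- `prev = reservations[tid][j].A` -/
  | enter (parent : Option ℕ)
  /-- fast path, `attempts` attempts left: `ret = *a`; with no attempt left go to the slow path -/
  | fastLoad (parent : Option ℕ) (prev : Era) (attempts : ℕ)
  /-- fast path: `new = global_era; if (prev == new) return ret` -/
  | fastEra (parent : Option ℕ) (prev : Era) (attempts : ℕ) (ret : Ptr)
  /-- fast path: `reservations[tid][j].A = new; prev = new` -/
  | fastPublish (parent : Option ℕ) (new : Era) (attempts : ℕ)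
  /-- `era = (parent == nullptr) ? ∞ : parent->alloc_era` -/
  | parentEra (parent : Option ℕ) (prev : Era)
  /-- `F&A(&counter_start, 1)` -/
  | start (prev era : Era)
  /-- `state[tid][j].pointer = a` -/
  | setPointer (prev era : Era)
  /-- `state[tid][j].era = era` -/
  | setEra (prev era : Era)
  /-- `tag = reservations[tid][j].B` -/
  | readTag (prev : Era)
  /-- `state[tid][j].result = { invptr, tag }` -/
  | request (prev : Era) (tag : ℕ)
  /-- slow-path loop: `ret = *a` -/
  | slowLoad (prev : Era) (tag : ℕ)
  /-- slow-path loop: `new = global_era; if (prev == new) ...` -/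
  | slowEra (prev : Era) (tag : ℕ) (ret : Ptr)
  /-- slow-path loop: `if (WCAS(&state[tid][j].result, { invptr, tag }, { nullptr, ∞ })) ...` -/
  | cancel (prev new : Era) (tag : ℕ) (ret : Ptr)
  /-- after a successful cancellation: `reservations[tid][j].B = tag + 1` -/
  | bump (tag : ℕ) (ret : Ptr)
  /-- slow-path loop: `WCAS(&reservations[tid][j], { prev, tag }, { new, tag }); prev = new` -/
  | update (prev new : Era) (tag : ℕ)
  /-- end of the slow-path loop: `{ rp, re } = state[tid][j].result`, repeat if `rp == invptr` -/
  | check (prev : Era) (tag : ℕ)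
  /-- helped: `reservations[tid][j] = { re, tag + 1 }` -/
  | accept (tag : ℕ) (rp : Ptr) (re : Era)
  /-- `F&A(&counter_end, 1); return ret` -/
  | finish (ret : Ptr)

/-- Control states of `help_thread(i, j, tid)`. -/
inductive HelpPc
  /-- `result = state[i][j].result; if (result.A != invptr) return` -/
  | readResult
  /-- `era = state[i][j].era` -/
  | readEra (resB : Era)
  /-- `reservations[tid][max_hes].A = era` -/
  | reserveParent (resB era : Era)
  /-- `ptr = state[i][j].pointer` -/
  | readPointer (resB : Era)
  /-- `tag = reservations[i][j].B`, and leave if `tag != result.B` -/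
  | readTag (resB : Era) (ptr : ℕ)
  /-- `prev = global_era` -/
  | readPrev (tag ptr : ℕ)
  /-- head of the helping loop: `reservations[tid][max_hes+1].A = prev` -/
  | publish (tag ptr : ℕ) (prev : ℕ)
  /-- helping loop: `ret = *ptr` -/
  | load (tag ptr : ℕ) (prev : ℕ)
  /-- helping loop: `new = global_era; if (prev == new) ...` -/
  | readNew (tag ptr : ℕ) (prev : ℕ) (ret : Ptr)
  /-- helping loop: `if (WCAS(&state[i][j].result, { invptr, tag }, { ret, new })) ...`; in either
  case the helping loop is left -/
  | produce (tag : ℕ) (ret : Ptr) (new : ℕ)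
  /-- hand-over loop: `old = reservations[i][j]; if (old.B != tag) break` -/
  | readOld (tag new : ℕ)
  /-- hand-over loop: `ok = WCAS(&reservations[i][j], old, { new, tag + 1 })`, repeat if `!ok` -/
  | handOver (tag new : ℕ) (old : Era × ℕ)
  /-- end of the helping loop: `prev = new`, repeat if `state[i][j].result == { invptr, tag }` -/
  | recheck (tag ptr : ℕ) (new : ℕ)
  /-- `reservations[tid][max_hes+1].A = ∞` -/
  | clear2
  /-- `reservations[tid][max_hes].A = ∞; return` -/
  | clear1

/-- Control states of `increment_era()`. -/
inductive IncPc (p : Params)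
  /-- `ce = counter_end` -/
  | readEnd
  /-- `cs = counter_start; if (cs - ce != 0) ...` -/
  | readStart (ce : ℕ)
  /-- loop over all `(i, j)` still in `todo`: `if (state[i][j].result.A == invptr) help_thread` -/
  | scan (todo : List (Fin p.threads × Fin p.maxHes))
  /-- inside `help_thread(i, j, tid)`; `rest` is what remains of the loop -/
  | help (i : Fin p.threads) (j : Fin p.maxHes) (rest : List (Fin p.threads × Fin p.maxHes))
      (h : HelpPc)
  /-- `F&A(&global_era, 1)` -/
  | add

/-- The operation from which `increment_era()` is called. -/
inductive Caller
  | alloc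
  | retire

/-- Control states of a thread. -/
inductive Pc (p : Params)
  /-- executing application code; `ret` is the value returned by the last operation -/
  | app (ret : Ptr)
  /-- inside `get_protected(a, j, parent)` -/
  | get (a : ℕ) (j : Fin p.maxHes) (g : GetPc)
  /-- inside `increment_era()` -/
  | inc (caller : Caller) (q : IncPc p)
  /-- `alloc_block`: `if (alloc_counter++ % era_freq == 0) increment_era()` -/
  | allocEnter
  /-- `alloc_block`: `b = malloc()` -/
  | allocMalloc
  /-- `alloc_block`: `e = global_era` -/
  | allocEra (b : ℕ)
  /-- `alloc_block`: `b->alloc_era = e; return b` -/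
  | allocStore (b e : ℕ)
  /-- `retire`: `e = global_era` -/
  | retireEra (b : ℕ)
  /-- `retire`: `b->retire_era = e`, and append `b` to the thread-local `retire_list` -/
  | retireStore (b e : ℕ)
  /-- `retire`: `if (retire_counter++ % cleanup_freq == 0) ...` -/
  | retireCount (e : ℕ)
  /-- `retire`: `if (b->retire_era == global_era) increment_era()`, then `cleanup()` -/
  | retireCompare (e : ℕ)
  /-- `cleanup`: loop over the blocks of `retire_list`; `ce = counter_end` -/
  | cleanNext (todo : List ℕ)
  /-- `cleanup`: check `b` against the normal and then the first special reservations -/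
  | cleanFirst (b ce : ℕ) (rest : List ℕ) (todo : List (Fin p.threads × Fin (p.maxHes + 2)))
  /-- `cleanup`: `if (ce == counter_start)` then `b` can be freed -/
  | cleanStart (b ce : ℕ) (rest : List ℕ)
  /-- `cleanup`: check `b` against the second special and then the normal reservations -/
  | cleanSecond (b : ℕ) (rest : List ℕ) (todo : List (Fin p.threads × Fin (p.maxHes + 2)))
  /-- `cleanup`: remove `b` from `retire_list`, and `free(b)` -/
  | cleanFree (b : ℕ) (rest : List ℕ)
  /-- `clear`: `reservations[tid][j].A = ∞` for all `j` in `todo` -/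
  | clearing (todo : List (Fin p.maxHes))

/-- A configuration: shared memory, thread-local variables, and control states. -/
structure Config (p : Params) where
  /-- application memory: the pointer stored in each cell -/
  mem : ℕ → Ptr
  /-- header fields of the blocks -/
  allocEra : ℕ → ℕ
  retireEra : ℕ → ℕ
  /-- the blocks currently handed out by the allocator -/
  allocated : Finset ℕ
  globalEra : ℕ
  counterStart : ℕ
  counterEnd : ℕ
  /-- pairs `{ A = era, B = tag }` -/
  reservations : Fin p.threads → Fin (p.maxHes + 2) → Era × ℕ
  state : Fin p.threads → Fin p.maxHes → SlotState
  allocCounter : Fin p.threads → ℕ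
  retireCounter : Fin p.threads → ℕ
  retireList : Fin p.threads → List ℕ
  pc : Fin p.threads → Pc p

namespace Config

/-- Move thread `t` to control state `q`. -/
def goto (c : Config p) (t : Fin p.threads) (q : Pc p) : Config p :=
  { c with pc := Function.update c.pc t q }

/-- Atomic write of a reservation pair. -/
def setRes (c : Config p) (i : Fin p.threads) (k : Fin (p.maxHes + 2)) (v : Era × ℕ) : Config p :=
  { c with reservations :=
      Function.update c.reservations i (Function.update (c.reservations i) k v) }

/-- Atomic write of the era component of a reservation. -/
def setResA (c : Config p) (i : Fin p.threads) (k : Fin (p.maxHes + 2)) (e : Era) : Config p :=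
  c.setRes i k (e, (c.reservations i k).2)

/-- Atomic write of the tag component of a reservation. -/
def setResB (c : Config p) (i : Fin p.threads) (k : Fin (p.maxHes + 2)) (tag : ℕ) : Config p :=
  c.setRes i k ((c.reservations i k).1, tag)

def setState (c : Config p) (i : Fin p.threads) (j : Fin p.maxHes) (s : SlotState) : Config p :=
  { c with state := Function.update c.state i (Function.update (c.state i) j s) }

def setResult (c : Config p) (i : Fin p.threads) (j : Fin p.maxHes) (r : Ptr × Era) : Config p :=
  c.setState i j { c.state i j with result := r }

/-- Is block `b` protected by the reservation `k` of thread `i`? -/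
def Covers (c : Config p) (b : ℕ) (i : Fin p.threads) (k : Fin (p.maxHes + 2)) : Prop :=
  (c.allocEra b : Era) ≤ (c.reservations i k).1 ∧ (c.reservations i k).1 ≤ (c.retireEra b : Era)

instance (c : Config p) (b : ℕ) (i : Fin p.threads) (k : Fin (p.maxHes + 2)) :
    Decidable (c.Covers b i k) := by
  unfold Covers; infer_instance

end Config

/-- All pairs `(i, j)`, in the order of the two nested loops of `increment_era`. -/
def allSlots (p : Params) : List (Fin p.threads × Fin p.maxHes) :=
  (List.finRange p.threads).flatMap fun i => (List.finRange p.maxHes).map fun j => (i, j)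

def normalSlots (p : Params) : List (Fin p.threads × Fin (p.maxHes + 2)) :=
  (allSlots p).map fun s => (s.1, normal s.2)

def special1Slots (p : Params) : List (Fin p.threads × Fin (p.maxHes + 2)) :=
  (List.finRange p.threads).map fun i => (i, special1)

def special2Slots (p : Params) : List (Fin p.threads × Fin (p.maxHes + 2)) :=
  (List.finRange p.threads).map fun i => (i, special2)

/-- One atomic step of thread `t` inside `get_protected(a, j, _)`. -/
def getStep (c : Config p) (t : Fin p.threads) (a : ℕ) (j : Fin p.maxHes) : GetPc → Config p
  | .enter parent =>
      c.goto t (.get a j (.fastLoad parent (c.reservations t (normal j)).1 p.maxAttempts))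
  | .fastLoad parent prev 0 => c.goto t (.get a j (.parentEra parent prev))
  | .fastLoad parent prev (k + 1) => c.goto t (.get a j (.fastEra parent prev k (c.mem a)))
  | .fastEra parent prev k ret =>
      if prev = (c.globalEra : Era) then c.goto t (.app ret)
      else c.goto t (.get a j (.fastPublish parent c.globalEra k))
  | .fastPublish parent new k =>
      (c.setResA t (normal j) new).goto t (.get a j (.fastLoad parent new k))
  | .parentEra none prev => c.goto t (.get a j (.start prev ⊤))
  | .parentEra (some b) prev => c.goto t (.get a j (.start prev (c.allocEra b)))
  | .start prev era =>
      { c with counterStart := c.counterStart + 1 }.goto t (.get a j (.setPointer prev era))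
  | .setPointer prev era =>
      (c.setState t j { c.state t j with pointer := a }).goto t (.get a j (.setEra prev era))
  | .setEra prev era =>
      (c.setState t j { c.state t j with era := era }).goto t (.get a j (.readTag prev))
  | .readTag prev => c.goto t (.get a j (.request prev (c.reservations t (normal j)).2))
  | .request prev tag =>
      (c.setResult t j (.inv, (tag : Era))).goto t (.get a j (.slowLoad prev tag))
  | .slowLoad prev tag => c.goto t (.get a j (.slowEra prev tag (c.mem a)))
  | .slowEra prev tag ret =>
      if prev = (c.globalEra : Era) then c.goto t (.get a j (.cancel prev c.globalEra tag ret))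
      else c.goto t (.get a j (.update prev c.globalEra tag))
  | .cancel prev new tag ret =>
      if (c.state t j).result = (.inv, (tag : Era)) then
        (c.setResult t j (.null, ⊤)).goto t (.get a j (.bump tag ret))
      else c.goto t (.get a j (.update prev new tag))
  | .bump tag ret => (c.setResB t (normal j) (tag + 1)).goto t (.get a j (.finish ret))
  | .update prev new tag =>
      if c.reservations t (normal j) = (prev, tag) then
        (c.setRes t (normal j) (new, tag)).goto t (.get a j (.check new tag))
      else c.goto t (.get a j (.check new tag))
  | .check prev tag =>
      if (c.state t j).result.1 = .inv then c.goto t (.get a j (.slowLoad prev tag))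
      else c.goto t (.get a j (.accept tag (c.state t j).result.1 (c.state t j).result.2))
  | .accept tag rp re => (c.setRes t (normal j) (re, tag + 1)).goto t (.get a j (.finish rp))
  | .finish ret => { c with counterEnd := c.counterEnd + 1 }.goto t (.app ret)

/-- One atomic step of thread `t` inside `help_thread(i, j, t)`; `inside q` is the control state
with the same call frame and `q` inside `help_thread`, and `done` is the one after the call. -/
def helpStep (c : Config p) (t i : Fin p.threads) (j : Fin p.maxHes) (inside : HelpPc → Pc p)
    (done : Pc p) : HelpPc → Config p
  | .readResult =>
      if (c.state i j).result.1 = .inv then c.goto t (inside (.readEra (c.state i j).result.2))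
      else c.goto t done
  | .readEra resB => c.goto t (inside (.reserveParent resB (c.state i j).era))
  | .reserveParent resB era => (c.setResA t special1 era).goto t (inside (.readPointer resB))
  | .readPointer resB => c.goto t (inside (.readTag resB (c.state i j).pointer))
  | .readTag resB ptr =>
      if ((c.reservations i (normal j)).2 : Era) = resB then
        c.goto t (inside (.readPrev (c.reservations i (normal j)).2 ptr))
      else c.goto t (inside .clear1)
  | .readPrev tag ptr => c.goto t (inside (.publish tag ptr c.globalEra))
  | .publish tag ptr prev => (c.setResA t special2 prev).goto t (inside (.load tag ptr prev))
  | .load tag ptr prev => c.goto t (inside (.readNew tag ptr prev (c.mem ptr)))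
  | .readNew tag ptr prev ret =>
      if prev = c.globalEra then c.goto t (inside (.produce tag ret c.globalEra))
      else c.goto t (inside (.recheck tag ptr c.globalEra))
  | .produce tag ret new =>
      if (c.state i j).result = (.inv, (tag : Era)) then
        (c.setResult i j (ret, (new : Era))).goto t (inside (.readOld tag new))
      else c.goto t (inside .clear2)
  | .readOld tag new =>
      if (c.reservations i (normal j)).2 = tag then
        c.goto t (inside (.handOver tag new (c.reservations i (normal j))))
      else c.goto t (inside .clear2)
  | .handOver tag new old =>
      if c.reservations i (normal j) = old then
        (c.setRes i (normal j) ((new : Era), tag + 1)).goto t (inside .clear2)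
      else c.goto t (inside (.readOld tag new))
  | .recheck tag ptr new =>
      if (c.state i j).result = (.inv, (tag : Era)) then c.goto t (inside (.publish tag ptr new))
      else c.goto t (inside .clear2)
  | .clear2 => (c.setResA t special2 ⊤).goto t (inside .clear1)
  | .clear1 => (c.setResA t special1 ⊤).goto t done

/-- Where `increment_era()` returns to; `cleanup` starts with the whole `retire_list`. -/
def afterInc (c : Config p) (t : Fin p.threads) : Caller → Pc p
  | .alloc => .allocMalloc
  | .retire => .cleanNext (c.retireList t)

/-- One atomic step of thread `t` inside `increment_era()`. -/
def incStep (c : Config p) (t : Fin p.threads) (caller : Caller) : IncPc p → Config p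
  | .readEnd => c.goto t (.inc caller (.readStart c.counterEnd))
  | .readStart ce =>
      if ce = c.counterStart then c.goto t (.inc caller .add)
      else c.goto t (.inc caller (.scan (allSlots p)))
  | .scan [] => c.goto t (.inc caller .add)
  | .scan ((i, j) :: rest) =>
      if (c.state i j).result.1 = .inv then c.goto t (.inc caller (.help i j rest .readResult))
      else c.goto t (.inc caller (.scan rest))
  | .help i j rest h =>
      helpStep c t i j (fun q => .inc caller (.help i j rest q)) (.inc caller (.scan rest)) h
  | .add => { c with globalEra := c.globalEra + 1 }.goto t (afterInc c t caller)

/-- One atomic step of thread `t` inside an operation (apart from `malloc`, whose result is not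
determined); meaningless in the two control states excluded by `Pc.Internal`. -/
def internalStep (c : Config p) (t : Fin p.threads) : Pc p → Config p
  | .app _ => c
  | .allocMalloc => c
  | .get a j g => getStep c t a j g
  | .inc caller q => incStep c t caller q
  | .allocEnter =>
      { c with allocCounter := Function.update c.allocCounter t (c.allocCounter t + 1) }.goto t
        (if c.allocCounter t % p.eraFreq = 0 then .inc .alloc .readEnd else .allocMalloc)
  | .allocEra b => c.goto t (.allocStore b c.globalEra)
  | .allocStore b e =>
      { c with allocEra := Function.update c.allocEra b e }.goto t (.app (.blk b))
  | .retireEra b => c.goto t (.retireStore b c.globalEra)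
  | .retireStore b e =>
      { c with
        retireEra := Function.update c.retireEra b e
        retireList := Function.update c.retireList t (c.retireList t ++ [b]) }.goto t
        (.retireCount e)
  | .retireCount e =>
      { c with retireCounter := Function.update c.retireCounter t (c.retireCounter t + 1) }.goto t
        (if c.retireCounter t % p.cleanupFreq = 0 then .retireCompare e else .app .null)
  | .retireCompare e =>
      c.goto t (if e = c.globalEra then .inc .retire .readEnd else .cleanNext (c.retireList t))
  | .cleanNext [] => c.goto t (.app .null)
  | .cleanNext (b :: rest) =>
      c.goto t (.cleanFirst b c.counterEnd rest (normalSlots p ++ special1Slots p))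
  | .cleanFirst b ce rest [] => c.goto t (.cleanStart b ce rest)
  | .cleanFirst b ce rest ((i, k) :: todo) =>
      c.goto t (if c.Covers b i k then .cleanNext rest else .cleanFirst b ce rest todo)
  | .cleanStart b ce rest =>
      c.goto t (if ce = c.counterStart then .cleanFree b rest
        else .cleanSecond b rest (special2Slots p ++ normalSlots p))
  | .cleanSecond b rest [] => c.goto t (.cleanFree b rest)
  | .cleanSecond b rest ((i, k) :: todo) =>
      c.goto t (if c.Covers b i k then .cleanNext rest else .cleanSecond b rest todo)
  | .cleanFree b rest =>
      { c with
        allocated := c.allocated.erase b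
        retireList := Function.update c.retireList t ((c.retireList t).erase b) }.goto t
        (.cleanNext rest)
  | .clearing [] => c.goto t (.app .null)
  | .clearing (j :: todo) => (c.setResA t (normal j) ⊤).goto t (.clearing todo)

/-- The control states whose next step is given by `internalStep`. -/
def Pc.Internal : Pc p → Prop
  | .app _ => False
  | .allocMalloc => False
  | _ => True

/-- `Step c t c'`: thread `t` can take one atomic step from `c` to `c'`. Application code may store
any pointer other than `invptr` anywhere in application memory and may call any operation with any
arguments. The allocator returns some block that is not in use. -/
inductive Step (c : Config p) (t : Fin p.threads) : Config p → Prop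
  | write (ret : Ptr) (h : c.pc t = .app ret) (a : ℕ) (v : Ptr) (hv : v ≠ .inv) :
      Step c t { c with mem := Function.update c.mem a v }
  | callGet (ret : Ptr) (h : c.pc t = .app ret) (a : ℕ) (j : Fin p.maxHes) (parent : Option ℕ) :
      Step c t (c.goto t (.get a j (.enter parent)))
  | callAlloc (ret : Ptr) (h : c.pc t = .app ret) : Step c t (c.goto t .allocEnter)
  | callRetire (ret : Ptr) (h : c.pc t = .app ret) (b : ℕ) : Step c t (c.goto t (.retireEra b))
  | callClear (ret : Ptr) (h : c.pc t = .app ret) :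
      Step c t (c.goto t (.clearing (List.finRange p.maxHes)))
  | malloc (h : c.pc t = .allocMalloc) (b : ℕ) (hb : b ∉ c.allocated) :
      Step c t ({ c with allocated := insert b c.allocated }.goto t (.allocEra b))
  | internal (h : (c.pc t).Internal) : Step c t (internalStep c t (c.pc t))

/-- Initial configurations. -/
structure IsInit (c : Config p) : Prop where
  mem : ∀ a, c.mem a ≠ .inv
  globalEra : c.globalEra = 1
  counterStart : c.counterStart = 0
  counterEnd : c.counterEnd = 0
  reservations : ∀ i k, c.reservations i k = (⊤, 0)
  state : ∀ i j, (c.state i j).result = (.null, ⊤)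
  allocCounter : ∀ i, c.allocCounter i = 0
  retireCounter : ∀ i, c.retireCounter i = 0
  retireList : ∀ i, c.retireList i = []
  pc : ∀ i, c.pc i = .app .null

/-- An execution under an arbitrary schedule: at time `k` thread `σ k` takes a step. No fairness
is assumed; a thread that is never scheduled again has crashed or been preempted. -/
structure IsExecution (c : ℕ → Config p) (σ : ℕ → Fin p.threads) : Prop where
  init : IsInit (c 0)
  step : ∀ k, Step (c k) (σ k) (c (k + 1))

/-- The control states inside a call of `alloc_block`. -/
def Pc.inAlloc : Pc p → Bool
  | .allocEnter => true
  | .inc .alloc _ => true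
  | .allocMalloc => true
  | .allocEra _ => true
  | .allocStore _ _ => true
  | _ => false

/-- The control states inside a call of `help_thread`. -/
def Pc.inHelp : Pc p → Bool
  | .inc _ (.help _ _ _ _) => true
  | _ => false

/-- About to begin an iteration of the helping loop of `help_thread`. -/
def Pc.atHelpLoop : Pc p → Bool
  | .inc _ (.help _ _ _ (.publish _ _ _)) => true
  | _ => false

/-- Inside an iteration of the hand-over loop of `help_thread` that found the tag intact, about to
execute its WCAS. -/
def Pc.atHandOver : Pc p → Bool
  | .inc _ (.help _ _ _ (.handOver _ _ _)) => true
  | _ => false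

/-- The number of steps that thread `t` takes during the time interval `[x, y)`. -/
def stepCount (σ : ℕ → Fin p.threads) (t : Fin p.threads) (x y : ℕ) : ℕ :=
  ((Finset.Ico x y).filter fun k => σ k = t).card

/-- The number of those steps that are taken from a control state satisfying `P`. -/
def stepCountAt (c : ℕ → Config p) (σ : ℕ → Fin p.threads) (t : Fin p.threads)
    (P : Pc p → Bool) (x y : ℕ) : ℕ :=
  ((Finset.Ico x y).filter fun k => σ k = t ∧ P ((c k).pc t) = true).card

/-- Thread `t` calls `alloc_block` at time `a`. -/
def CallsAllocAt (c : ℕ → Config p) (σ : ℕ → Fin p.threads) (t : Fin p.threads) (a : ℕ) : Prop :=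
  σ a = t ∧ (∃ ret, (c a).pc t = .app ret) ∧ (c (a + 1)).pc t = .allocEnter

/-- The call of `alloc_block` made by `t` at time `a` returns a block at time `r`. -/
def AllocReturnsAt (c : ℕ → Config p) (t : Fin p.threads) (a r : ℕ) : Prop :=
  a < r ∧ (∀ k ∈ Finset.Ioo a r, ((c k).pc t).inAlloc = true) ∧ ∃ b, (c r).pc t = .app (.blk b)

/-- `alloc_block` is wait-free with at most `B` steps per call: in every execution, a thread inside
the call is never blocked, and once it has taken `B` steps of its own after the invocation the call
has returned, whatever the other threads do. -/
def AllocWaitFreeBounded (p : Params) (B : ℕ) : Prop :=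
  ∀ (c : ℕ → Config p) (σ : ℕ → Fin p.threads), IsExecution c σ →
    (∀ (t : Fin p.threads) (k : ℕ), ((c k).pc t).inAlloc = true → ∃ c', Step (c k) t c') ∧
    ∀ (t : Fin p.threads) (a : ℕ), CallsAllocAt c σ t a →
      ∀ b, B ≤ stepCount σ t (a + 1) b → ∃ r ≤ b, AllocReturnsAt c t a r

/-- In every execution, the number of steps taken from a control state satisfying `P` during a
single call of `help_thread` is at most `N`. (Two calls of `help_thread` by the same thread are
separated by a control state outside `help_thread`.) -/
def PerHelpCallBound (p : Params) (P : Pc p → Bool) (N : ℕ) : Prop :=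
  ∀ (c : ℕ → Config p) (σ : ℕ → Fin p.threads), IsExecution c σ →
    ∀ (t : Fin p.threads) (x y : ℕ), (∀ k ∈ Finset.Ico x y, ((c k).pc t).inHelp = true) →
      stepCountAt c σ t P x y ≤ N

end WFE

/-! For each pair `(i, j)` only three things matter: the phase of the owner in its request, the
`result` pair and the reservation pair. This triple, a `Slot`, changes only by moves of the owner
(`Slot.Own`) or of helpers (`Slot.Help`). Tags never decrease, and a request with tag `T`, once
answered or cancelled, never becomes pending again; the stable predicates `Used` and `Done` express
what a helper may rely on.

Helping loop. While a request is pending, its owner lies between its increments of the two counters,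
so `counter_end < counter_start` (`Inv.counterEnd_lt`). Hence a thread that enters `increment_era`
during that time notices the difference and attends to the request before it increments the era.
Only threads already past the check (`Pc.Stale`) can increment without doing so, and each of them
only once: the number of stale threads plus the era does not grow (`Step.staleCount`). The helper
itself is not stale, so the era changes at most `n - 1` times, and the loop repeats only if the era
changed.

Hand-over loop. The WCAS fails only if the reservation changed after it was read. Once a result has
been produced, the owner can update the era at most once before it sees the result and increments
the tag; a rival hand-over increments the tag at once. So there are at most two changes, the last of
which ends the loop (`Slot.changes`, `handBound`).

With both loops bounded, `helpRank` bounds one call of `help_thread` by `4n + 14` steps, and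
`allocRank` decreases with every step of the caller and is not increased by steps of the others. -/

namespace WFE

variable {p : Params}

/-! ### Slots as an abstraction of the protocol between owner and helpers -/

/-- Where the owner of a slot stands in a slow-path request for it; `T` is the request's tag. -/
inductive Phase
  | idle
  /-- about to publish the request -/
  | req (T : ℕ)
  /-- in the slow-path loop, up to the WCAS on the reservation -/
  | pre (T : ℕ)
  /-- at the end of the slow-path loop -/
  | post (T : ℕ)
  /-- about to accept the result of a helper -/
  | acc (T : ℕ)
  /-- about to increment the tag after a cancellation -/
  | bump (T : ℕ)

def GetPc.phase : GetPc → Phase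
  | .request _ T => .req T
  | .slowLoad _ T => .pre T
  | .slowEra _ T _ => .pre T
  | .cancel _ _ T _ => .pre T
  | .update _ _ T => .pre T
  | .check _ T => .post T
  | .accept T _ _ => .acc T
  | .bump T _ => .bump T
  | _ => .idle

def Pc.phase (j : Fin p.maxHes) : Pc p → Phase
  | .get _ j' g => if j' = j then g.phase else .idle
  | _ => .idle

/-- The tag of a published and not yet completed request. -/
def Phase.tag : Phase → Option ℕ
  | .idle => none
  | .req _ => none
  | .pre T => some T
  | .post T => some T
  | .acc T => some T
  | .bump T => some T

/-- What matters about a pair `(i, j)` for the protocol between its owner and the helpers. -/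
structure Slot where
  phase : Phase
  result : Ptr × Era
  res : Era × ℕ

def Config.slot (c : Config p) (i : Fin p.threads) (j : Fin p.maxHes) : Slot :=
  ⟨(c.pc i).phase j, (c.state i j).result, c.reservations i (normal j)⟩

/-- Effect of a step of the owner on its slot. -/
inductive Slot.Own : Slot → Slot → Prop
  | idle (r : Ptr × Era) (s s' : Era × ℕ) (h : s'.2 = s.2) : Own ⟨.idle, r, s⟩ ⟨.idle, r, s'⟩
  | readTag (r : Ptr × Era) (s : Era × ℕ) : Own ⟨.idle, r, s⟩ ⟨.req s.2, r, s⟩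
  | request (T : ℕ) (r : Ptr × Era) (s : Era × ℕ) :
      Own ⟨.req T, r, s⟩ ⟨.pre T, (.inv, (T : Era)), s⟩
  | loop (T : ℕ) (r : Ptr × Era) (s : Era × ℕ) : Own ⟨.pre T, r, s⟩ ⟨.pre T, r, s⟩
  | cancel (T : ℕ) (s : Era × ℕ) :
      Own ⟨.pre T, (.inv, (T : Era)), s⟩ ⟨.bump T, (.null, ⊤), s⟩
  | update (T : ℕ) (r : Ptr × Era) (s s' : Era × ℕ) (h : s'.2 = s.2) :
      Own ⟨.pre T, r, s⟩ ⟨.post T, r, s'⟩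
  | again (T : ℕ) (r : Ptr × Era) (s : Era × ℕ) (h : r.1 = .inv) :
      Own ⟨.post T, r, s⟩ ⟨.pre T, r, s⟩
  | helped (T : ℕ) (r : Ptr × Era) (s : Era × ℕ) (h : r.1 ≠ .inv) :
      Own ⟨.post T, r, s⟩ ⟨.acc T, r, s⟩
  | accept (T : ℕ) (r : Ptr × Era) (s s' : Era × ℕ) (h : s'.2 = T + 1) :
      Own ⟨.acc T, r, s⟩ ⟨.idle, r, s'⟩
  | bump (T : ℕ) (r : Ptr × Era) (s s' : Era × ℕ) (h : s'.2 = T + 1) :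
      Own ⟨.bump T, r, s⟩ ⟨.idle, r, s'⟩

/-- Effect on a slot of a step of a thread inside `help_thread` for that slot. -/
inductive Slot.Help : HelpPc → Slot → Slot → Prop
  | none (h : HelpPc) (x : Slot) : Help h x x
  | produce (T : ℕ) (ret : Ptr) (new : ℕ) (ph : Phase) (s : Era × ℕ) :
      Help (.produce T ret new) ⟨ph, (.inv, (T : Era)), s⟩ ⟨ph, (ret, (new : Era)), s⟩
  | handOver (T new : ℕ) (old : Era × ℕ) (ph : Phase) (r : Ptr × Era) :
      Help (.handOver T new old) ⟨ph, r, old⟩ ⟨ph, r, ((new : Era), T + 1)⟩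

theorem normal_injective : Function.Injective (normal (p := p)) :=
  Fin.castAdd_injective _ _

theorem normal_ne_special1 (j : Fin p.maxHes) : normal j ≠ special1 := by
  intro h
  have := congrArg Fin.val h
  simp [normal, special1] at this
  omega

theorem normal_ne_special2 (j : Fin p.maxHes) : normal j ≠ special2 := by
  intro h
  have := congrArg Fin.val h
  simp [normal, special2] at this
  omega

/-! ### Projections of the elementary updates -/

namespace Config

variable (c : Config p) (t i : Fin p.threads)

@[simp] theorem goto_pc (q : Pc p) : (c.goto t q).pc = Function.update c.pc t q := rfl
@[simp] theorem goto_mem (q : Pc p) : (c.goto t q).mem = c.mem := rfl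
@[simp] theorem goto_globalEra (q : Pc p) : (c.goto t q).globalEra = c.globalEra := rfl
@[simp] theorem goto_counterStart (q : Pc p) : (c.goto t q).counterStart = c.counterStart := rfl
@[simp] theorem goto_counterEnd (q : Pc p) : (c.goto t q).counterEnd = c.counterEnd := rfl
@[simp] theorem goto_reservations (q : Pc p) : (c.goto t q).reservations = c.reservations := rfl
@[simp] theorem goto_state (q : Pc p) : (c.goto t q).state = c.state := rfl

variable (k : Fin (p.maxHes + 2)) (v : Era × ℕ)

@[simp] theorem setRes_pc : (c.setRes i k v).pc = c.pc := rfl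
@[simp] theorem setRes_mem : (c.setRes i k v).mem = c.mem := rfl
@[simp] theorem setRes_globalEra : (c.setRes i k v).globalEra = c.globalEra := rfl
@[simp] theorem setRes_counterStart : (c.setRes i k v).counterStart = c.counterStart := rfl
@[simp] theorem setRes_counterEnd : (c.setRes i k v).counterEnd = c.counterEnd := rfl
@[simp] theorem setRes_state : (c.setRes i k v).state = c.state := rfl

theorem setRes_reservations (i' : Fin p.threads) (k' : Fin (p.maxHes + 2)) :
    (c.setRes i k v).reservations i' k' =
      if i' = i ∧ k' = k then v else c.reservations i' k' := by
  by_cases h : i' = i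
  · subst h
    by_cases h' : k' = k
    · subst h'; simp [setRes]
    · simp [setRes, h']
  · simp [setRes, h]

variable (j : Fin p.maxHes) (s : SlotState) (r : Ptr × Era)

@[simp] theorem setState_pc : (c.setState i j s).pc = c.pc := rfl
@[simp] theorem setState_mem : (c.setState i j s).mem = c.mem := rfl
@[simp] theorem setState_globalEra : (c.setState i j s).globalEra = c.globalEra := rfl
@[simp] theorem setState_counterStart : (c.setState i j s).counterStart = c.counterStart := rfl
@[simp] theorem setState_counterEnd : (c.setState i j s).counterEnd = c.counterEnd := rfl
@[simp] theorem setState_reservations : (c.setState i j s).reservations = c.reservations := rfl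

theorem setState_state (i' : Fin p.threads) (j' : Fin p.maxHes) :
    (c.setState i j s).state i' j' = if i' = i ∧ j' = j then s else c.state i' j' := by
  by_cases h : i' = i
  · subst h
    by_cases h' : j' = j
    · subst h'; simp [setState]
    · simp [setState, h']
  · simp [setState, h]

end Config

/-! ### The action of steps on slots -/

/-- A step of `get_protected` concerns only the slot of the executing thread it is called for. -/
theorem slot_getStep (c : Config p) (t : Fin p.threads) (a : ℕ) (j : Fin p.maxHes) (g : GetPc)
    (hpc : c.pc t = .get a j g) :
    (c.slot t j).Own ((getStep c t a j g).slot t j) ∧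
      ∀ i' j', (i', j') ≠ (t, j) → (getStep c t a j g).slot i' j' = c.slot i' j' := by
  constructor
  · unfold getStep
    split <;> (try split_ifs) <;>
      simp_all [Config.slot, Pc.phase, GetPc.phase, Config.setRes_reservations,
        Config.setState_state, Config.setResA, Config.setResB, Config.setResult]
    all_goals first
      | exact .idle _ _ _ rfl
      | exact .readTag _ _
      | exact .request _ _ _
      | exact .loop _ _ _
      | exact .cancel _ _
      | exact .update _ _ _ _ rfl
      | exact .again _ _ _ ‹_›
      | exact .helped _ _ _ ‹_›
      | exact .accept _ _ _ _ rfl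
      | exact .bump _ _ _ _ rfl
  · intro i' j' hne
    unfold getStep
    by_cases hi : i' = t
    · have hj : ¬ j = j' := by rintro rfl; exact hne (by rw [hi])
      have hj' : ¬ j' = j := fun h => hj h.symm
      subst hi
      split <;> (try split_ifs) <;>
        simp [Config.slot, Pc.phase, hpc, hj, hj', Config.setRes_reservations,
          normal_injective.eq_iff, Config.setState_state, Config.setResA, Config.setResB,
          Config.setResult]
    · split <;> (try split_ifs) <;>
        simp [Config.slot, hi, Config.setRes_reservations,
          Config.setState_state, Config.setResA, Config.setResB, Config.setResult]

/-- A step inside `help_thread` concerns only the slot it is called for. -/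
theorem slot_helpStep (c : Config p) (t i : Fin p.threads) (j : Fin p.maxHes)
    (inside : HelpPc → Pc p) (done : Pc p) (h : HelpPc)
    (hpc : ∀ j, (c.pc t).phase j = .idle) (hin : ∀ q j, (inside q).phase j = .idle)
    (hdone : ∀ j, done.phase j = .idle) :
    (c.slot i j).Help h ((helpStep c t i j inside done h).slot i j) ∧
      ∀ i' j', (i', j') ≠ (i, j) →
        (helpStep c t i j inside done h).slot i' j' = c.slot i' j' := by
  -- The helper may own the slot it is examining. Its move within `help_thread` still leaves every
  -- phase unchanged, because a thread there is idle for all its own slots.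
  have hphase : ∀ q i' j', (∀ j, q.phase j = .idle) →
      (Function.update c.pc t q i').phase j' = (c.pc i').phase j' := by
    intro q i' j' hq
    by_cases hi : i' = t
    · subst hi; simp [hq, hpc]
    · simp [hi]
  constructor
  · unfold helpStep
    split <;> (try split_ifs) <;>
      simp_all [Config.slot, Config.setRes_reservations, Config.setState_state,
        Config.setResA, Config.setResult, normal_ne_special1, normal_ne_special2]
    all_goals first
      | exact .none _ _
      | exact .produce _ _ _ _ _
      | exact .handOver _ _ _ _ _
  · intro i' j' hne
    have hij : i' = i → ¬ j' = j := by rintro rfl rfl; exact hne rfl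
    unfold helpStep
    split <;> (try split_ifs) <;>
      simp_all [Config.slot, Config.setRes_reservations, Config.setState_state,
        Config.setResA, Config.setResult, normal_ne_special1, normal_ne_special2,
        normal_injective.eq_iff]
    all_goals
      by_cases hi : i' = i
      · simp [hi, hij]
      · simp [hi]

/-- Every step is, as far as a given slot is concerned, invisible, a step of the owner, or a step
of a helper. -/
theorem slot_step {c c' : Config p} {t : Fin p.threads} (hs : Step c t c')
    (i : Fin p.threads) (j : Fin p.maxHes) :
    c'.slot i j = c.slot i j ∨ (t = i ∧ (c.slot i j).Own (c'.slot i j)) ∨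
      ∃ caller rest h, c.pc t = .inc caller (.help i j rest h) ∧
        (c.slot i j).Help h (c'.slot i j) := by
  have hmove : ∀ (q : Pc p) (i' : Fin p.threads), (c.pc t).phase j = .idle → q.phase j = .idle →
      (Function.update c.pc t q i').phase j = (c.pc i').phase j := by
    intro q i' h h'
    by_cases hi : i' = t
    · subst hi; simp [h, h']
    · simp [hi]
  cases hs with
  | write ret h a v hv => exact .inl rfl
  | callGet ret h a j' parent =>
    left
    simp only [Config.slot, Config.goto_pc, Config.goto_state, Config.goto_reservations]
    rw [hmove _ _ (by rw [h]; rfl) (by simp [Pc.phase, GetPc.phase])]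
  | callAlloc ret h =>
    left
    simp only [Config.slot, Config.goto_pc, Config.goto_state, Config.goto_reservations]
    rw [hmove _ _ (by rw [h]; rfl) rfl]
  | callRetire ret h b =>
    left
    simp only [Config.slot, Config.goto_pc, Config.goto_state, Config.goto_reservations]
    rw [hmove _ _ (by rw [h]; rfl) rfl]
  | callClear ret h =>
    left
    simp only [Config.slot, Config.goto_pc, Config.goto_state, Config.goto_reservations]
    rw [hmove _ _ (by rw [h]; rfl) rfl]
  | malloc h b hb =>
    left
    simp only [Config.slot, Config.goto_pc, Config.goto_state, Config.goto_reservations]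
    rw [hmove _ _ (by rw [h]; rfl) rfl]
  | internal h =>
    cases hpc : c.pc t with
    | get a j' g =>
      obtain ⟨h1, h2⟩ := slot_getStep c t a j' g hpc
      by_cases hij : (i, j) = (t, j')
      · obtain ⟨rfl, rfl⟩ := Prod.mk.inj hij
        exact .inr (.inl ⟨rfl, h1⟩)
      · exact .inl (h2 i j hij)
    | inc caller q =>
      cases q with
      | help i' j' rest h =>
        obtain ⟨h1, h2⟩ := slot_helpStep c t i' j'
          (fun q => .inc caller (.help i' j' rest q)) (.inc caller (.scan rest)) h
          (fun j => by rw [hpc]; rfl) (fun _ _ => rfl) (fun _ => rfl)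
        by_cases hij : (i, j) = (i', j')
        · obtain ⟨rfl, rfl⟩ := Prod.mk.inj hij
          exact .inr (.inr ⟨caller, rest, h, rfl, h1⟩)
        · exact .inl (h2 i j hij)
      | _ =>
        left
        simp only [internalStep]
        unfold incStep
        split <;> (try split_ifs) <;> (try contradiction) <;>
          simp only [Config.slot, Config.goto_pc, Config.goto_state, Config.goto_reservations] <;>
          rw [hmove _ _ (by rw [hpc]; rfl) (by first | rfl | (cases caller <;> rfl))]
    | clearing todo =>
      cases todo with
      | nil =>
        left
        simp only [internalStep, Config.slot, Config.goto_pc, Config.goto_state,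
          Config.goto_reservations]
        rw [hmove _ _ (by rw [hpc]; rfl) rfl]
      | cons j' todo =>
        -- `clear` does alter the slot, but only the era of the reservation, so it counts as an idle
        -- move of the owner.
        by_cases hij : i = t ∧ j = j'
        · obtain ⟨rfl, rfl⟩ := hij
          refine .inr (.inl ⟨rfl, ?_⟩)
          simp only [internalStep, Config.slot, Config.goto_pc, Config.goto_state,
            Config.goto_reservations, Config.setResA, Config.setRes_pc, Config.setRes_state]
          rw [hmove _ _ (by rw [hpc]; rfl) rfl, hpc]
          exact .idle _ _ _ (by simp [Config.setRes_reservations])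
        · left
          simp only [internalStep, Config.slot, Config.goto_pc, Config.goto_state,
            Config.goto_reservations, Config.setResA, Config.setRes_pc, Config.setRes_state,
            Config.setRes_reservations, normal_injective.eq_iff, hij, if_false]
          rw [hmove _ _ (by rw [hpc]; rfl) rfl]
    | app ret => rw [hpc] at h; exact h.elim
    | allocMalloc => rw [hpc] at h; exact h.elim
    | _ =>
      left
      simp only [internalStep]
      (try split) <;> (try split_ifs) <;> (try contradiction) <;>
        simp only [Config.slot, Config.goto_pc, Config.goto_state, Config.goto_reservations] <;>
        rw [hmove _ _ (by rw [hpc]; rfl) rfl]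

/-! ### Counters, clock and control states -/

/-- The steps of `get_protected` between the increments of `counter_start` and `counter_end`. -/
def GetPc.slow : GetPc → ℕ
  | .enter _ => 0
  | .fastLoad _ _ _ => 0
  | .fastEra _ _ _ _ => 0
  | .fastPublish _ _ _ => 0
  | .parentEra _ _ => 0
  | .start _ _ => 0
  | _ => 1

def Pc.slow : Pc p → ℕ
  | .get _ _ g => g.slow
  | _ => 0

def Pc.adding : Pc p → Prop
  | .inc _ .add => True
  | _ => False

/-- The effect of a step on what is not recorded in the slots. -/
structure Frame (c : Config p) (t : Fin p.threads) (c' : Config p) : Prop where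
  pc : ∀ u, u ≠ t → c'.pc u = c.pc u
  mem : (∀ a, c.mem a ≠ .inv) → ∀ a, c'.mem a ≠ .inv
  era : c'.globalEra = c.globalEra ∨ c'.globalEra = c.globalEra + 1 ∧ (c.pc t).adding
  start : c.counterStart ≤ c'.counterStart
  slow : c'.counterStart + c.counterEnd + (c.pc t).slow =
    c.counterStart + c'.counterEnd + (c'.pc t).slow

theorem frame_of_goto {c d : Config p} {t : Fin p.threads} {q : Pc p}
    (hpc : d.pc = c.pc) (hmem : d.mem = c.mem) (hera : d.globalEra = c.globalEra)
    (hstart : d.counterStart = c.counterStart) (hend : d.counterEnd = c.counterEnd)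
    (hslow : (c.pc t).slow = q.slow) : Frame c t (d.goto t q) where
  pc u hu := by simp [hpc, hu]
  mem h := by simpa [hmem] using h
  era := .inl hera
  start := hstart.ge
  slow := by simp [hstart, hend, hslow]

theorem frame_getStep (c : Config p) (t : Fin p.threads) (a : ℕ) (j : Fin p.maxHes) (g : GetPc)
    (hpc : c.pc t = .get a j g) : Frame c t (getStep c t a j g) := by
  unfold getStep
  split
  -- This case is `start` and `h_20` is `finish`, the only two steps that change a counter.
  case h_8 =>
    refine ⟨fun u hu => by simp [hu], fun h => h, .inl rfl, Nat.le_succ _, ?_⟩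
    simp [hpc, Pc.slow, GetPc.slow]; omega
  case h_20 =>
    refine ⟨fun u hu => by simp [hu], fun h => h, .inl rfl, le_rfl, ?_⟩
    simp [hpc, Pc.slow, GetPc.slow]; omega
  all_goals
    (try split_ifs) <;> exact frame_of_goto rfl rfl rfl rfl rfl (by rw [hpc]; rfl)

theorem frame_helpStep (c : Config p) (t i : Fin p.threads) (j : Fin p.maxHes)
    (inside : HelpPc → Pc p) (done : Pc p) (h : HelpPc)
    (hpc : (c.pc t).slow = 0) (hin : ∀ q, (inside q).slow = 0) (hdone : done.slow = 0) :
    Frame c t (helpStep c t i j inside done h) := by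
  unfold helpStep
  split <;> (try split_ifs) <;>
    exact frame_of_goto rfl rfl rfl rfl rfl (by rw [hpc]; first | rw [hin] | rw [hdone])

theorem Step.frame {c c' : Config p} {t : Fin p.threads} (hs : Step c t c') : Frame c t c' := by
  cases hs with
  | write ret h a v hv =>
    refine ⟨fun _ _ => rfl, fun hm a' => ?_, .inl rfl, le_rfl, rfl⟩
    by_cases ha : a' = a
    · subst ha; simpa using hv
    · simpa [ha] using hm a'
  | callGet ret h a j' parent =>
    exact frame_of_goto rfl rfl rfl rfl rfl (by rw [h]; rfl)
  | callAlloc ret h => exact frame_of_goto rfl rfl rfl rfl rfl (by rw [h]; rfl)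
  | callRetire ret h b => exact frame_of_goto rfl rfl rfl rfl rfl (by rw [h]; rfl)
  | callClear ret h => exact frame_of_goto rfl rfl rfl rfl rfl (by rw [h]; rfl)
  | malloc h b hb => exact frame_of_goto rfl rfl rfl rfl rfl (by rw [h]; rfl)
  | internal h =>
    cases hpc : c.pc t with
    | get a j' g => exact frame_getStep c t a j' g hpc
    | inc caller q =>
      cases q with
      | help i' j' rest h =>
        exact frame_helpStep c t i' j' (fun q => .inc caller (.help i' j' rest q))
          (.inc caller (.scan rest)) h (by rw [hpc]; rfl) (fun _ => rfl) rfl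
      | add =>
        refine ⟨fun u hu => by simp [internalStep, incStep, hu], fun h => h,
          .inr ⟨rfl, by rw [hpc]; trivial⟩, le_rfl, ?_⟩
        cases caller <;> simp [hpc, internalStep, incStep, afterInc, Pc.slow]
      | _ =>
        simp only [internalStep]
        unfold incStep
        split <;> (try split_ifs) <;> (try contradiction) <;>
          exact frame_of_goto rfl rfl rfl rfl rfl (by rw [hpc]; rfl)
    | app ret => rw [hpc] at h; exact h.elim
    | allocMalloc => rw [hpc] at h; exact h.elim
    | _ =>
      simp only [internalStep]
      (try split) <;> (try split_ifs) <;> (try contradiction) <;>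
        exact frame_of_goto rfl rfl rfl rfl rfl (by rw [hpc]; rfl)

theorem Step.counters {c c' : Config p} {t : Fin p.threads} (hs : Step c t c')
    (h : c.counterStart = c.counterEnd + ∑ u, (c.pc u).slow) :
    c'.counterStart = c'.counterEnd + ∑ u, (c'.pc u).slow := by
  have hf := hs.frame
  have e1 := Finset.add_sum_erase Finset.univ (fun u => (c.pc u).slow) (Finset.mem_univ t)
  have e2 := Finset.add_sum_erase Finset.univ (fun u => (c'.pc u).slow) (Finset.mem_univ t)
  have e3 : ∑ u ∈ Finset.univ.erase t, (c'.pc u).slow = ∑ u ∈ Finset.univ.erase t, (c.pc u).slow :=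
    Finset.sum_congr rfl fun u hu => by rw [hf.pc u (Finset.ne_of_mem_erase hu)]
  have e4 := hf.slow
  omega

/-! ### Invariants of a slot -/

namespace Slot

/-- The invariant relating the phase of the owner with the result and the tag of the slot. -/
def Good (x : Slot) : Prop :=
  match x.phase with
  | .idle => x.result.1 ≠ .inv
  | .req T => x.result.1 ≠ .inv ∧ x.res.2 = T
  | .pre T | .post T =>
      (x.result.1 = .inv → x.result = (.inv, (T : Era)) ∧ x.res.2 = T) ∧
        T ≤ x.res.2 ∧ x.res.2 ≤ T + 1
  | .acc T | .bump T => x.result.1 ≠ .inv ∧ T ≤ x.res.2 ∧ x.res.2 ≤ T + 1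

/-- The tag `T` has been used by a request: it is not the tag of a future request. -/
def Used (T : ℕ) (x : Slot) : Prop :=
  T ≤ x.res.2 ∧ (T = x.res.2 → x.phase.tag = some T)

/-- The request with tag `T` has obtained a result from a helper. -/
def Done (T : ℕ) (x : Slot) : Prop :=
  T ≤ x.res.2 ∧ (T = x.res.2 → x.result.1 ≠ .inv ∧
    (x.phase = .pre T ∨ x.phase = .post T ∨ x.phase = .acc T))

/-- What a helper knows about the slot. -/
def HelpOK (x : Slot) : HelpPc → Prop
  | .readEra resB => ∀ T : ℕ, resB = (T : Era) → x.Used T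
  | .reserveParent resB _ => ∀ T : ℕ, resB = (T : Era) → x.Used T
  | .readPointer resB => ∀ T : ℕ, resB = (T : Era) → x.Used T
  | .readTag resB _ => ∀ T : ℕ, resB = (T : Era) → x.Used T
  | .readPrev tag _ => x.Used tag
  | .publish tag _ _ => x.Used tag
  | .load tag _ _ => x.Used tag
  | .readNew tag _ _ ret => x.Used tag ∧ ret ≠ .inv
  | .produce tag ret _ => x.Used tag ∧ ret ≠ .inv
  | .readOld tag _ => x.Done tag
  | .handOver tag _ old => x.Done tag ∧ old.2 = tag
  | .recheck tag _ _ => x.Used tag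
  | _ => True

variable {x y : Slot}

theorem Own.good (h : Own x y) (hx : x.Good) : y.Good := by
  cases h <;> simp_all [Good]

/-- The delicate move is the hand-over, which increments the tag on behalf of the owner. A
successful WCAS means that the tag is still the one of the answered request; then `Done` places the
owner in phase `pre`, `post` or `acc`, where `T + 1` is an admissible tag. -/
theorem Help.good {h : HelpPc} (hxy : Help h x y) (hok : x.HelpOK h) (hx : x.Good) : y.Good := by
  cases hxy with
  | none => exact hx
  | produce T ret new ph s => cases ph <;> simp_all [Good, HelpOK]
  | handOver T new old ph r =>
    obtain ⟨⟨h1, h2⟩, h3⟩ := hok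
    obtain ⟨h4, h5 | h5 | h5⟩ := h2 h3.symm <;> simp_all [Good]

/-- When the owner completes a request it raises the tag above `T`, so leaving the phases with tag
`T` does not violate `Used`. -/
theorem Own.used (h : Own x y) (hx : x.Good) {T : ℕ} (he : x.Used T) : y.Used T := by
  cases h <;> simp [Good, Used, Phase.tag] at * <;> grind

theorem Help.used {h : HelpPc} (hxy : Help h x y) (hok : x.HelpOK h) {T : ℕ}
    (he : x.Used T) : y.Used T := by
  cases hxy <;> simp [Used, HelpOK] at * <;> grind

/-- With a result present the owner can no longer cancel nor start another round from `post`; it can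
only move towards `accept`, which raises the tag. -/
theorem Own.done (h : Own x y) (hx : x.Good) {T : ℕ} (he : x.Done T) : y.Done T := by
  cases h <;> simp [Good, Done] at * <;> grind

theorem Help.done {h : HelpPc} (hxy : Help h x y) (hok : x.HelpOK h) {T : ℕ}
    (he : x.Done T) : y.Done T := by
  cases hxy <;> simp [Done, HelpOK] at * <;> grind

/-- This excludes an ABA problem on `result`. Publishing the tag `T` anew would start from phase
`req T` with reservation tag `T`, whereas `Used` says that at this tag the request is already
published. -/
theorem Own.pending (h : Own x y) (hx : x.Good) {T : ℕ} (he : x.Used T)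
    (hy : y.result = (.inv, (T : Era))) : x.result = (.inv, (T : Era)) := by
  cases h <;> simp [Good, Used, Phase.tag] at * <;> grind

end Slot

/-! ### The transition relation of a helper -/

/-- The moves of `help_thread`: from `x` and `h` to `y` and the next control state, if any, where
`g` is the current era. -/
inductive HelpMove (g : ℕ) : Slot → Slot → HelpPc → Option HelpPc → Prop
  | skip (x : Slot) (hx : x.result.1 ≠ .inv) : HelpMove g x x .readResult none
  | readResult (x : Slot) (hx : x.result.1 = .inv) :
      HelpMove g x x .readResult (some (.readEra x.result.2))
  | readEra (x : Slot) (resB era : Era) :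
      HelpMove g x x (.readEra resB) (some (.reserveParent resB era))
  | reserveParent (x : Slot) (resB era : Era) :
      HelpMove g x x (.reserveParent resB era) (some (.readPointer resB))
  | readPointer (x : Slot) (resB : Era) (ptr : ℕ) :
      HelpMove g x x (.readPointer resB) (some (.readTag resB ptr))
  | readTag (x : Slot) (ptr : ℕ) :
      HelpMove g x x (.readTag (x.res.2 : Era) ptr) (some (.readPrev x.res.2 ptr))
  | giveUp (x : Slot) (resB : Era) (ptr : ℕ) (hx : (x.res.2 : Era) ≠ resB) :
      HelpMove g x x (.readTag resB ptr) (some .clear1)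
  | readPrev (x : Slot) (tag ptr : ℕ) :
      HelpMove g x x (.readPrev tag ptr) (some (.publish tag ptr g))
  | publish (x : Slot) (tag ptr prev : ℕ) :
      HelpMove g x x (.publish tag ptr prev) (some (.load tag ptr prev))
  | load (x : Slot) (tag ptr prev : ℕ) (ret : Ptr) (hr : ret ≠ .inv) :
      HelpMove g x x (.load tag ptr prev) (some (.readNew tag ptr prev ret))
  | stable (x : Slot) (tag ptr : ℕ) (ret : Ptr) :
      HelpMove g x x (.readNew tag ptr g ret) (some (.produce tag ret g))
  | changed (x : Slot) (tag ptr prev : ℕ) (ret : Ptr) (hp : prev ≠ g) :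
      HelpMove g x x (.readNew tag ptr prev ret) (some (.recheck tag ptr g))
  | produce (tag : ℕ) (ret : Ptr) (new : ℕ) (ph : Phase) (s : Era × ℕ) :
      HelpMove g ⟨ph, (.inv, (tag : Era)), s⟩ ⟨ph, (ret, (new : Era)), s⟩ (.produce tag ret new)
        (some (.readOld tag new))
  | late (x : Slot) (tag : ℕ) (ret : Ptr) (new : ℕ) (hx : x.result ≠ (.inv, (tag : Era))) :
      HelpMove g x x (.produce tag ret new) (some .clear2)
  | readOld (x : Slot) (new : ℕ) :
      HelpMove g x x (.readOld x.res.2 new) (some (.handOver x.res.2 new x.res))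
  | leave (x : Slot) (tag new : ℕ) (hx : x.res.2 ≠ tag) :
      HelpMove g x x (.readOld tag new) (some .clear2)
  | handOver (tag new : ℕ) (old : Era × ℕ) (ph : Phase) (r : Ptr × Era) :
      HelpMove g ⟨ph, r, old⟩ ⟨ph, r, ((new : Era), tag + 1)⟩ (.handOver tag new old)
        (some .clear2)
  | retry (x : Slot) (tag new : ℕ) (old : Era × ℕ) (hx : x.res ≠ old) :
      HelpMove g x x (.handOver tag new old) (some (.readOld tag new))
  | again (x : Slot) (tag ptr new : ℕ) (hx : x.result = (.inv, (tag : Era))) :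
      HelpMove g x x (.recheck tag ptr new) (some (.publish tag ptr new))
  | quit (x : Slot) (tag ptr new : ℕ) (hx : x.result ≠ (.inv, (tag : Era))) :
      HelpMove g x x (.recheck tag ptr new) (some .clear2)
  | clear2 (x : Slot) : HelpMove g x x .clear2 (some .clear1)
  | clear1 (x : Slot) : HelpMove g x x .clear1 none

theorem helpMove_helpStep (c : Config p) (t i : Fin p.threads) (j : Fin p.maxHes)
    (inside : HelpPc → Pc p) (done : Pc p) (h : HelpPc) (hmem : ∀ a, c.mem a ≠ .inv)
    (hpc : ∀ j, (c.pc t).phase j = .idle) (hin : ∀ q j, (inside q).phase j = .idle)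
    (hdone : ∀ j, done.phase j = .idle) :
    ∃ o, HelpMove c.globalEra (c.slot i j) ((helpStep c t i j inside done h).slot i j) h o ∧
      (helpStep c t i j inside done h).pc t = o.elim done inside := by
  have hphase : ∀ q i' j', (∀ j, q.phase j = .idle) →
      (Function.update c.pc t q i').phase j' = (c.pc i').phase j' := by
    intro q i' j' hq
    by_cases hi : i' = t
    · subst hi; simp [hq, hpc]
    · simp [hi]
  -- Covers every step except the two successful WCAS operations: writes to special reservations are
  -- invisible in the slot.
  have key : ∀ (d : Config p) (o : Option HelpPc), d.state = c.state →
      d.reservations i (normal j) = c.reservations i (normal j) → d.pc = c.pc →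
      HelpMove c.globalEra (c.slot i j) (c.slot i j) h o →
      ∃ o', HelpMove c.globalEra (c.slot i j) ((d.goto t (o.elim done inside)).slot i j) h o' ∧
        (d.goto t (o.elim done inside)).pc t = o'.elim done inside := by
    intro d o h1 h2 h3 h4
    refine ⟨o, ?_, by simp⟩
    have : (d.goto t (o.elim done inside)).slot i j = c.slot i j := by
      simp only [Config.slot, Config.goto_pc, Config.goto_state, Config.goto_reservations,
        h1, h2, h3]
      rw [hphase]
      cases o <;> simp [hin, hdone]
    rwa [this]
  cases h with
  | readResult =>
    simp only [helpStep]
    split_ifs with hx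
    · exact key c (some _) rfl rfl rfl (.readResult _ hx)
    · exact key c none rfl rfl rfl (.skip _ hx)
  | readEra resB => exact key c (some _) rfl rfl rfl (.readEra _ _ _)
  | reserveParent resB era =>
    exact key (c.setResA t special1 era) (some _) rfl
      (by simp [Config.setResA, Config.setRes_reservations, normal_ne_special1]) rfl
      (.reserveParent _ _ _)
  | readPointer resB => exact key c (some _) rfl rfl rfl (.readPointer _ _ _)
  | readTag resB ptr =>
    simp only [helpStep]
    split_ifs with hx
    · subst hx
      exact key c (some _) rfl rfl rfl (.readTag _ _)
    · exact key c (some _) rfl rfl rfl (.giveUp _ _ _ hx)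
  | readPrev tag ptr => exact key c (some _) rfl rfl rfl (.readPrev _ _ _)
  | publish tag ptr prev =>
    exact key (c.setResA t special2 prev) (some _) rfl
      (by simp [Config.setResA, Config.setRes_reservations, normal_ne_special2]) rfl
      (.publish _ _ _ _)
  | load tag ptr prev => exact key c (some _) rfl rfl rfl (.load _ _ _ _ _ (hmem _))
  | readNew tag ptr prev ret =>
    simp only [helpStep]
    split_ifs with hx
    · subst hx
      exact key c (some _) rfl rfl rfl (.stable _ _ _ _)
    · exact key c (some _) rfl rfl rfl (.changed _ _ _ _ _ hx)
  | produce tag ret new =>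
    simp only [helpStep]
    split_ifs with hx
    · refine ⟨some (.readOld tag new), ?_, by simp⟩
      simp only [Config.slot, hx, Config.goto_pc, Config.goto_state, Config.goto_reservations,
        Config.setResult, Config.setState_pc, Config.setState_state, and_self, if_true,
        Config.setState_reservations]
      rw [hphase _ _ _ (hin _)]
      exact .produce _ _ _ _ _
    · exact key c (some _) rfl rfl rfl (.late _ _ _ _ hx)
  | readOld tag new =>
    simp only [helpStep]
    split_ifs with hx
    · subst hx
      exact key c (some _) rfl rfl rfl (.readOld _ _)
    · exact key c (some _) rfl rfl rfl (.leave _ _ _ hx)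
  | handOver tag new old =>
    simp only [helpStep]
    split_ifs with hx
    · refine ⟨some .clear2, ?_, by simp⟩
      simp only [Config.slot, hx, Config.goto_pc, Config.goto_state, Config.goto_reservations,
        Config.setRes_pc, Config.setRes_reservations, and_self, if_true, Config.setRes_state]
      rw [hphase _ _ _ (hin _)]
      exact .handOver _ _ _ _ _
    · exact key c (some _) rfl rfl rfl (.retry _ _ _ _ hx)
  | recheck tag ptr new =>
    simp only [helpStep]
    split_ifs with hx
    · exact key c (some _) rfl rfl rfl (.again _ _ _ _ hx)
    · exact key c (some _) rfl rfl rfl (.quit _ _ _ _ hx)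
  | clear2 =>
    exact key (c.setResA t special2 ⊤) (some _) rfl
      (by simp [Config.setResA, Config.setRes_reservations, normal_ne_special2]) rfl (.clear2 _)
  | clear1 =>
    exact key (c.setResA t special1 ⊤) none rfl
      (by simp [Config.setResA, Config.setRes_reservations, normal_ne_special1]) rfl (.clear1 _)

/-! ### The invariant of the configurations -/

theorem HelpMove.help {g : ℕ} {x y : Slot} {h : HelpPc} {o : Option HelpPc}
    (hm : HelpMove g x y h o) : x.Help h y := by
  cases hm with
  | produce => exact .produce _ _ _ _ _
  | handOver => exact .handOver _ _ _ _ _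
  | _ => exact .none _ _

/-- Knowledge is gained in two places. On reading `invptr`, `Good` identifies the tag found as that
of the published request, which yields `Used`. On a successful WCAS of `result`, `Good` gives the
matching phase and tag, which yields `Done`. -/
theorem HelpMove.helpOK {g : ℕ} {x y : Slot} {h h' : HelpPc} (hm : HelpMove g x y h (some h'))
    (hx : x.Good) (hok : x.HelpOK h) : y.HelpOK h' := by
  cases hm with
  | readResult _ hr =>
    obtain ⟨ph, r, s⟩ := x
    intro T hT
    cases ph <;> simp_all [Slot.Good, Slot.Used, Phase.tag]
  | readTag => exact hok _ rfl
  | load _ _ _ _ _ hr => exact ⟨hok, hr⟩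
  | stable => exact hok
  | changed => exact hok.1
  | produce tag ret new ph s =>
    cases ph <;> simp_all [Slot.Good, Slot.Used, Slot.Done, Slot.HelpOK, Phase.tag]
  | readOld => exact ⟨hok, rfl⟩
  | retry => exact hok.1
  | late => trivial
  | handOver => trivial
  | giveUp => trivial
  | leave => trivial
  | quit => trivial
  | clear2 => trivial
  | _ => exact hok

/-- Beyond facts about its local variables, a helper knows only instances of `Used` and `Done`.
Their stability therefore protects its knowledge against interference. -/
theorem Slot.HelpOK.mono {x y : Slot} {h : HelpPc} (hok : x.HelpOK h)
    (hu : ∀ T, x.Used T → y.Used T) (hd : ∀ T, x.Done T → y.Done T) : y.HelpOK h := by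
  cases h with
  | readEra => exact fun T hT => hu T (hok T hT)
  | reserveParent => exact fun T hT => hu T (hok T hT)
  | readPointer => exact fun T hT => hu T (hok T hT)
  | readTag => exact fun T hT => hu T (hok T hT)
  | readPrev => exact hu _ hok
  | publish => exact hu _ hok
  | load => exact hu _ hok
  | readNew => exact ⟨hu _ hok.1, hok.2⟩
  | produce => exact ⟨hu _ hok.1, hok.2⟩
  | readOld => exact hd _ hok
  | handOver => exact ⟨hd _ hok.1, hok.2⟩
  | recheck => exact hu _ hok
  | _ => trivial

structure Inv (c : Config p) : Prop where
  mem : ∀ a, c.mem a ≠ .inv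
  counters : c.counterStart = c.counterEnd + ∑ u, (c.pc u).slow
  good : ∀ i j, (c.slot i j).Good
  helpOK : ∀ t caller i j rest h, c.pc t = .inc caller (.help i j rest h) →
    (c.slot i j).HelpOK h

/-- How a thread moves with respect to `help_thread`. -/
theorem Step.help_cases {c c' : Config p} {t : Fin p.threads} (hs : Step c t c')
    (hmem : ∀ a, c.mem a ≠ .inv) :
    (∃ caller i j rest h o, c.pc t = .inc caller (.help i j rest h) ∧
      HelpMove c.globalEra (c.slot i j) (c'.slot i j) h o ∧
      c'.pc t = o.elim (.inc caller (.scan rest)) fun h' => .inc caller (.help i j rest h')) ∨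
    (c.pc t).inHelp = false ∧ ∀ caller i j rest h, c'.pc t = .inc caller (.help i j rest h) →
      h = .readResult ∧ c.pc t = .inc caller (.scan ((i, j) :: rest)) := by
  cases hs with
  | write ret h => exact .inr ⟨by rw [h]; rfl, by simp [h]⟩
  | callGet ret h => exact .inr ⟨by rw [h]; rfl, by simp⟩
  | callAlloc ret h => exact .inr ⟨by rw [h]; rfl, by simp⟩
  | callRetire ret h => exact .inr ⟨by rw [h]; rfl, by simp⟩
  | callClear ret h => exact .inr ⟨by rw [h]; rfl, by simp⟩
  | malloc h => exact .inr ⟨by rw [h]; rfl, by simp⟩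
  | internal h =>
    cases hpc : c.pc t with
    | get a j' g =>
      refine .inr ⟨rfl, ?_⟩
      simp only [internalStep]
      unfold getStep
      split <;> (try split_ifs) <;> simp
    | inc caller q =>
      cases q with
      | help i' j' rest h =>
        obtain ⟨o, h1, h2⟩ := helpMove_helpStep c t i' j'
          (fun q => .inc caller (.help i' j' rest q)) (.inc caller (.scan rest)) h hmem
          (fun j => by rw [hpc]; rfl) (fun _ _ => rfl) (fun _ => rfl)
        exact .inl ⟨caller, i', j', rest, h, o, rfl, h1, h2⟩
      | _ =>
        refine .inr ⟨rfl, ?_⟩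
        simp only [internalStep]
        unfold incStep
        split <;> (try split_ifs) <;> (try contradiction) <;> (try simp [afterInc]) <;>
          (try cases caller) <;> simp_all
    | app ret => rw [hpc] at h; exact h.elim
    | allocMalloc => rw [hpc] at h; exact h.elim
    | _ =>
      refine .inr ⟨rfl, ?_⟩
      simp only [internalStep]
      (try split) <;> (try split_ifs) <;> (try contradiction) <;> simp

theorem Inv.step {c c' : Config p} {t : Fin p.threads} (hi : Inv c) (hs : Step c t c') :
    Inv c' := by
  have hslot : ∀ i j, (c'.slot i j).Good ∧ (∀ T, (c.slot i j).Used T → (c'.slot i j).Used T) ∧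
      ∀ T, (c.slot i j).Done T → (c'.slot i j).Done T := by
    intro i j
    rcases slot_step hs i j with h | ⟨-, h⟩ | ⟨caller, rest, h, hpc, hm⟩
    · rw [h]
      exact ⟨hi.good i j, fun _ => id, fun _ => id⟩
    · exact ⟨h.good (hi.good i j), fun _ => h.used (hi.good i j), fun _ => h.done (hi.good i j)⟩
    · have hok := hi.helpOK _ _ _ _ _ _ hpc
      exact ⟨hm.good hok (hi.good i j), fun _ => hm.used hok, fun _ => hm.done hok⟩
  refine ⟨hs.frame.mem hi.mem, hs.counters hi.counters, fun i j => (hslot i j).1, ?_⟩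
  intro u caller i j rest h hpc
  by_cases hu : u = t
  · subst hu
    rcases hs.help_cases hi.mem with ⟨caller₁, i₁, j₁, rest₁, h₁, o, h2, h3, h4⟩ | ⟨-, h2⟩
    · rw [hpc] at h4
      cases o with
      | none => simp at h4
      | some h' =>
        simp only [Option.elim, Pc.inc.injEq, IncPc.help.injEq] at h4
        obtain ⟨rfl, rfl, rfl, rfl, rfl⟩ := h4
        exact h3.helpOK (hi.good _ _) (hi.helpOK _ _ _ _ _ _ h2)
    · obtain ⟨rfl, -⟩ := h2 _ _ _ _ _ hpc
      trivial
  · rw [hs.frame.pc u hu] at hpc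
    exact (hi.helpOK _ _ _ _ _ _ hpc).mono (hslot i j).2.1 (hslot i j).2.2

theorem IsInit.inv {c : Config p} (h : IsInit c) : Inv c where
  mem := h.mem
  counters := by simp [h.counterStart, h.counterEnd, h.pc, Pc.slow]
  good i j := by simp [Slot.Good, Config.slot, h.pc, h.state, Pc.phase]
  helpOK t caller i j rest h' hpc := by simp [h.pc] at hpc

/-! ### Stale threads -/

/-- A helper in this control state completes the request with tag `T` before it leaves. -/
def HelpPc.Engaged (T : ℕ) : HelpPc → Prop
  | .readResult => True
  | .readEra resB => resB = (T : Era)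
  | .reserveParent resB _ => resB = (T : Era)
  | .readPointer resB => resB = (T : Era)
  | .readTag resB _ => resB = (T : Era)
  | .readPrev tag _ => tag = T
  | .publish tag _ _ => tag = T
  | .load tag _ _ => tag = T
  | .readNew tag _ _ _ => tag = T
  | .produce tag _ _ => tag = T
  | .recheck tag _ _ => tag = T
  | _ => False

/-- A thread in this control state may increment the era before it has seen to the pending request
`(i, j)` with tag `T`; here `cs` is the value of `counter_start`. -/
def Pc.Stale (cs : ℕ) (i : Fin p.threads) (j : Fin p.maxHes) (T : ℕ) : Pc p → Prop
  | .inc _ (.readStart ce) => cs ≤ ce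
  | .inc _ (.scan todo) => (i, j) ∉ todo
  | .inc _ (.help i' j' rest h) => (i, j) ∉ rest ∧ ¬ ((i', j') = (i, j) ∧ h.Engaged T)
  | .inc _ .add => True
  | _ => False

open Classical in
-- An upper bound for the number of times the era can still change while the request stays pending.
noncomputable def Config.staleCount (c : Config p) (i : Fin p.threads) (j : Fin p.maxHes) (T : ℕ) : ℕ :=
  (Finset.univ.filter fun u => (c.pc u).Stale c.counterStart i j T).card

theorem mem_allSlots (i : Fin p.threads) (j : Fin p.maxHes) : (i, j) ∈ allSlots p := by
  simp [allSlots]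

theorem HelpMove.engaged {g : ℕ} {x y : Slot} {h : HelpPc} {o : Option HelpPc}
    (hm : HelpMove g x y h o) {T : ℕ} (hgood : x.Good) (hx : x.result = (.inv, (T : Era)))
    (hy : y.result = (.inv, (T : Era))) (hok : x.HelpOK h) (he : h.Engaged T) :
    ∃ h', o = some h' ∧ h'.Engaged T := by
  cases hm <;> simp_all [HelpPc.Engaged, Slot.HelpOK]
  -- Giving up at the tag comparison is impossible: while the request is pending, `Good` keeps the
  -- tag of the reservation at `T`.
  obtain ⟨ph, r, s⟩ := x
  cases ph <;> simp_all [Slot.Good]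

/-- While a request is pending, its owner is between the increments of the two counters. -/
theorem Inv.counterEnd_lt {c : Config p} (hc : Inv c) {i : Fin p.threads} {j : Fin p.maxHes}
    (h : (c.slot i j).result.1 = .inv) : c.counterEnd < c.counterStart := by
  have h1 : (c.pc i).slow = 1 := by
    have hg := hc.good i j
    cases hpc : c.pc i with
    | get a j' g =>
      by_cases hj : j' = j
      · cases g <;>
          simp_all [Slot.Good, Config.slot, Pc.phase, GetPc.phase, Pc.slow, GetPc.slow]
      · simp_all [Slot.Good, Config.slot, Pc.phase]
    | _ => simp_all [Slot.Good, Config.slot, Pc.phase]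
  have h2 : (c.pc i).slow ≤ ∑ u, (c.pc u).slow :=
    Finset.single_le_sum (f := fun u => (c.pc u).slow) (fun _ _ => Nat.zero_le _)
      (Finset.mem_univ i)
  have := hc.counters
  omega

/-- No step under a pending request creates staleness. A fresh `readEnd` records a value below
`counter_start`, a difference leads to a scan that contains `(i, j)`, the scan cannot skip `(i, j)`,
and an engaged helper cannot leave while the request is pending. The clause on `adding` says that
incrementing the era ends staleness. -/
theorem Step.stale {c c' : Config p} {t : Fin p.threads} (hs : Step c t c') (hc : Inv c)
    {i : Fin p.threads} {j : Fin p.maxHes} {T : ℕ}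
    (hx : (c.slot i j).result = (.inv, (T : Era))) (hy : (c'.slot i j).result = (.inv, (T : Era)))
    (hst : (c'.pc t).Stale c'.counterStart i j T) :
    (c.pc t).Stale c.counterStart i j T ∧ ¬ (c.pc t).adding := by
  have hlt : c.counterEnd < c.counterStart := hc.counterEnd_lt (by rw [hx])
  rcases hs.help_cases hc.mem with ⟨caller, i₁, j₁, rest, h, o, hpc, hm, hpc'⟩ | ⟨hno, -⟩
  · rw [hpc'] at hst
    rw [hpc]
    refine ⟨?_, fun h => h⟩
    cases o with
    | none =>
      refine ⟨hst, ?_⟩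
      rintro ⟨heq, he⟩
      obtain ⟨rfl, rfl⟩ := Prod.mk.inj heq
      obtain ⟨h', h1, -⟩ := hm.engaged (hc.good _ _) hx hy (hc.helpOK _ _ _ _ _ _ hpc) he
      cases h1
    | some h' =>
      refine ⟨hst.1, ?_⟩
      rintro ⟨heq, he⟩
      obtain ⟨rfl, rfl⟩ := Prod.mk.inj heq
      obtain ⟨h'', h1, h2⟩ := hm.engaged (hc.good _ _) hx hy (hc.helpOK _ _ _ _ _ _ hpc) he
      cases h1
      exact hst.2 ⟨rfl, h2⟩
  · cases hs with
    | write ret h => rw [h] at hst; exact hst.elim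
    | callGet ret h => simp [Pc.Stale] at hst
    | callAlloc ret h => simp [Pc.Stale] at hst
    | callRetire ret h => simp [Pc.Stale] at hst
    | callClear ret h => simp [Pc.Stale] at hst
    | malloc h => simp [Pc.Stale] at hst
    | internal h =>
      cases hpc : c.pc t with
      | get a j' g =>
        exfalso
        revert hst
        rw [hpc]
        simp only [internalStep]
        unfold getStep
        split <;> (try split_ifs) <;> simp [Pc.Stale]
      | inc caller q =>
        revert hst
        rw [hpc]
        cases q with
        | readEnd => simp [internalStep, incStep, Pc.Stale, hlt]
        | readStart ce =>
          simp only [internalStep, incStep]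
          split_ifs with hce
          · simp [Pc.Stale, Pc.adding, hce]
          · simp [Pc.Stale, mem_allSlots]
        | scan todo =>
          cases todo with
          | nil => simp [internalStep, incStep, Pc.Stale, Pc.adding]
          | cons s rest =>
            obtain ⟨i₁, j₁⟩ := s
            simp only [internalStep, incStep]
            split_ifs with hr
            · simp [Pc.Stale, Pc.adding, HelpPc.Engaged]
              grind
            · have : ¬ (i = i₁ ∧ j = j₁) := by
                rintro ⟨rfl, rfl⟩
                exact hr (by rw [show (c.state i j).result = _ from hx])
              simp [Pc.Stale, Pc.adding]
              grind
        | help i₁ j₁ rest h => rw [hpc] at hno; cases hno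
        | add => cases caller <;> simp [internalStep, incStep, Pc.Stale, afterInc]
      | app ret => rw [hpc] at h; exact h.elim
      | allocMalloc => rw [hpc] at h; exact h.elim
      | _ =>
        exfalso
        revert hst
        rw [hpc]
        simp only [internalStep]
        (try split) <;> (try split_ifs) <;> (try contradiction) <;> simp [Pc.Stale]

/-- While a request is pending, every increment of the era uses up a stale thread. -/
theorem Step.staleCount {c c' : Config p} {t : Fin p.threads} (hs : Step c t c') (hc : Inv c)
    {i : Fin p.threads} {j : Fin p.maxHes} {T : ℕ}
    (hx : (c.slot i j).result = (.inv, (T : Era)))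
    (hy : (c'.slot i j).result = (.inv, (T : Era))) :
    c'.staleCount i j T + c'.globalEra ≤ c.staleCount i j T + c.globalEra := by
  classical
  have hsub : ∀ u, (c'.pc u).Stale c'.counterStart i j T → (c.pc u).Stale c.counterStart i j T := by
    intro u hu
    by_cases hut : u = t
    · subst hut
      exact (hs.stale hc hx hy hu).1
    · rw [hs.frame.pc u hut] at hu
      -- A thread that did not move can only cease to be stale: `counter_start` may grow past the
      -- value of `counter_end` it has read.
      have := hs.frame.start
      revert hu
      unfold Pc.Stale
      split <;> simp <;> omega
  rcases hs.frame.era with he | ⟨he, hadd⟩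
  · rw [he]
    refine Nat.add_le_add_right (Finset.card_le_card ?_) _
    intro u
    simpa using hsub u
  · have : c'.staleCount i j T < c.staleCount i j T := by
      refine Finset.card_lt_card ⟨?_, ?_⟩
      · intro u
        simpa using hsub u
      · intro hss
        have h1 : (c.pc t).Stale c.counterStart i j T := by
          revert hadd
          unfold Pc.adding
          split
          · intro _
            rw [‹c.pc t = _›]
            trivial
          · exact False.elim
        have h2 := hss (by simpa using h1 : t ∈ _)
        exact (hs.stale hc hx hy (by simpa using h2)).2 hadd
    omega

theorem Config.staleCount_lt (c : Config p) {i : Fin p.threads} {j : Fin p.maxHes} {T : ℕ}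
    {t : Fin p.threads} (ht : ¬ (c.pc t).Stale c.counterStart i j T) :
    c.staleCount i j T < p.threads := by
  classical
  have : c.staleCount i j T < (Finset.univ : Finset (Fin p.threads)).card := by
    refine Finset.card_lt_card ⟨Finset.subset_univ _, fun h => ht ?_⟩
    simpa using h (Finset.mem_univ t)
  simpa using this

/-! ### The helping loop -/

/-- A bound for the number of iterations of the helping loop still to come, in a system of `n`
threads where `S T` threads are stale for the request with tag `T` and `g` is the era. -/
def loopBound (n : ℕ) (x : Slot) (S : ℕ → ℕ) (g : ℕ) : HelpPc → ℕ
  | .publish tag _ prev =>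
      if x.result = (.inv, (tag : Era)) then 1 + S tag + (g - prev) else 1
  | .load tag _ prev => if x.result = (.inv, (tag : Era)) then S tag + (g - prev) else 0
  | .readNew tag _ prev _ => if x.result = (.inv, (tag : Era)) then S tag + (g - prev) else 0
  | .recheck tag _ new =>
      if x.result = (.inv, (tag : Era)) then 1 + S tag + (g - new) else 0
  | .produce _ _ _ => 0
  | .readOld _ _ => 0
  | .handOver _ _ _ => 0
  | .clear2 => 0
  | .clear1 => 0
  | _ => n

/-- The last era read by the helper. -/
def HelpPc.lastEra : HelpPc → ℕ
  | .publish _ _ prev => prev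
  | .load _ _ prev => prev
  | .readNew _ _ prev _ => prev
  | .recheck _ _ new => new
  | _ => 0

/-- `y`, `S'`, `g'` may come after `x`, `S`, `g`. -/
structure Later (x : Slot) (S : ℕ → ℕ) (g : ℕ) (y : Slot) (S' : ℕ → ℕ) (g' : ℕ) : Prop where
  era : g ≤ g'
  pending : ∀ T, x.Used T → y.result = (.inv, (T : Era)) → x.result = (.inv, (T : Era)) ∧
    S' T + g' ≤ S T + g

theorem Step.later {c c' : Config p} {t : Fin p.threads} (hs : Step c t c') (hc : Inv c)
    (i : Fin p.threads) (j : Fin p.maxHes) :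
    Later (c.slot i j) (c.staleCount i j) c.globalEra (c'.slot i j) (c'.staleCount i j)
      c'.globalEra := by
  refine ⟨by rcases hs.frame.era with h | h <;> omega, fun T hT hy => ?_⟩
  have hx : (c.slot i j).result = (.inv, (T : Era)) := by
    rcases slot_step hs i j with h | ⟨-, h⟩ | ⟨caller, rest, h, hpc, hm⟩
    · rwa [← h]
    · exact h.pending (hc.good i j) hT hy
    · have hok := hc.helpOK _ _ _ _ _ _ hpc
      generalize c.slot i j = x at *
      generalize c'.slot i j = y at *
      cases hm with
      | none => exact hy
      | produce T' ret new ph s =>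
        have := hok.2
        simp_all
      | handOver => exact hy
  exact ⟨hx, hs.staleCount hc hx hy⟩

/-- The bound adds the eras that stale threads may still produce to those, `g - prev`, that the
helper has not yet noticed. An increment moves one unit from the first to the second. If the request
ceases to be pending, at most the iteration about to begin remains. -/
theorem loopBound_later {n : ℕ} {x y : Slot} {S S' : ℕ → ℕ} {g g' : ℕ} {h : HelpPc}
    (hl : Later x S g y S' g') (hok : x.HelpOK h) :
    loopBound n y S' g' h ≤ loopBound n x S g h := by
  have := hl.era
  have hp := hl.pending
  cases h with
  | publish tag ptr prev =>
    have := hp tag hok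
    simp only [loopBound]; split_ifs <;> grind
  | load tag ptr prev =>
    have := hp tag hok
    simp only [loopBound]; split_ifs <;> grind
  | readNew tag ptr prev ret =>
    have := hp tag hok.1
    simp only [loopBound]; split_ifs <;> grind
  | recheck tag ptr new =>
    have := hp tag hok
    simp only [loopBound]; split_ifs <;> grind
  | _ => exact le_rfl

def HelpPc.atLoop : HelpPc → ℕ
  | .publish _ _ _ => 1
  | _ => 0

theorem HelpMove.lastEra {g : ℕ} {x y : Slot} {h h' : HelpPc} (hm : HelpMove g x y h (some h'))
    (he : h.lastEra ≤ g) : h'.lastEra ≤ g := by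
  cases hm <;> simp_all [HelpPc.lastEra]

theorem loopBound_move {n : ℕ} {x y : Slot} {S S' : ℕ → ℕ} {g : ℕ} {h h' : HelpPc}
    (hm : HelpMove g x y h (some h')) (hl : Later x S g y S' g) (hok : x.HelpOK h)
    (he : h.lastEra ≤ g) (hS : ∀ T, h'.Engaged T → S' T < n) (hn : 0 < n) :
    loopBound n y S' g h' + h.atLoop ≤ loopBound n x S g h := by
  -- The change of the stale counts is treated separately from the change of control state. Only the
  -- two WCAS moves alter the slot, and for them the bound is `0` whatever the slot.
  have key : loopBound n x S' g h ≤ loopBound n x S g h := by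
    cases hm with
    | produce => exact le_rfl
    | handOver => exact le_rfl
    | _ => exact loopBound_later hl hok
  refine le_trans ?_ key
  cases hm with
  | changed _ tag ptr prev ret hp =>
    -- A different era is a later one, so `g - prev` is at least `1` and pays for the next
    -- iteration.
    have : prev < g := lt_of_le_of_ne he hp
    simp only [loopBound, HelpPc.atLoop]; split_ifs <;> omega
  | readPrev _ tag ptr =>
    -- Being engaged, the helper is not stale, so at most `n - 1` threads are; this leaves room for
    -- the first iteration.
    have := hS tag rfl
    simp only [loopBound, HelpPc.atLoop]; split_ifs <;> omega
  | publish => simp only [loopBound, HelpPc.atLoop]; split_ifs <;> omega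
  | again _ _ _ _ hx => simp [loopBound, HelpPc.atLoop, hx]
  | _ => simp [loopBound, HelpPc.atLoop]

/-! ### The hand-over loop -/

/-- A bound for the number of changes of the reservation that the owner can still make with the
tag `T` intact or in order to increment it, once a helper has produced a result. -/
def Slot.changes (x : Slot) (T : ℕ) : ℕ :=
  if x.res.2 = T then
    match x.phase with
    | .post _ => 1
    | .acc _ => 1
    | _ => 2
  else 0

/-- A bound for the number of WCAS operations of the hand-over loop still to come. -/
def handBound (x : Slot) : HelpPc → ℕ
  | .readOld tag _ => x.changes tag
  | .handOver tag _ old => if x.res = old then x.changes tag else x.changes tag + 1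
  | .clear2 => 0
  | .clear1 => 0
  | _ => 2

theorem Slot.changes_le (x : Slot) (T : ℕ) : x.changes T ≤ 2 := by
  unfold Slot.changes; split_ifs <;> (try split) <;> omega

theorem Slot.changes_pos {x : Slot} {T : ℕ} (h : x.res.2 = T) : 1 ≤ x.changes T := by
  unfold Slot.changes; rw [if_pos h]; split <;> omega

/-- At tag `T`, `Done` allows only `pre`, `post` and `acc`, and the way back from `post` is closed.
A change of the reservation is thus either the one update from `pre` to `post` or the acceptance,
which changes the tag. -/
theorem Slot.Own.changes {x y : Slot} (h : Own x y) (hx : x.Good) {T : ℕ} (hd : x.Done T) :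
    y.changes T ≤ x.changes T ∧ (y.res ≠ x.res → y.changes T + 1 ≤ x.changes T ∨ x.res.2 ≠ T) := by
  cases h <;> simp [Good, Done, Slot.changes] at * <;> grind

theorem Slot.Help.changes {x y : Slot} {h : HelpPc} (hm : x.Help h y) (hok : x.HelpOK h) {T : ℕ}
    (hd : x.Done T) :
    y.changes T ≤ x.changes T ∧ (y.res ≠ x.res → y.changes T + 1 ≤ x.changes T ∨ x.res.2 ≠ T) := by
  cases hm <;> simp [HelpOK, Done, Slot.changes] at * <;> grind

/-- A step that dooms the next WCAS by changing the reservation uses up one unit of `changes`, which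
compensates for the additional unit in `handBound`. -/
theorem handBound_later {x y : Slot} {h : HelpPc} (hok : x.HelpOK h)
    (hc : ∀ T, x.Done T → y.changes T ≤ x.changes T ∧
      (y.res ≠ x.res → y.changes T + 1 ≤ x.changes T ∨ x.res.2 ≠ T)) :
    handBound y h ≤ handBound x h := by
  cases h with
  | readOld tag new => exact (hc tag hok).1
  | handOver tag new old =>
    have h1 := hc tag hok.1
    have h2 : old.2 = tag := hok.2
    simp only [handBound]
    split_ifs with h3 h4 h4
    · exact h1.1
    · omega
    · subst h4
      have := h1.2 h3
      omega
    · omega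
  | _ => exact le_rfl

def HelpPc.atHandOver : HelpPc → ℕ
  | .handOver _ _ _ => 1
  | _ => 0

theorem handBound_move {x y : Slot} {g : ℕ} {h h' : HelpPc}
    (hm : HelpMove g x y h (some h')) (hok : x.HelpOK h) :
    handBound y h' + h.atHandOver ≤ handBound x h := by
  cases hm with
  | produce => simpa [handBound, HelpPc.atHandOver] using Slot.changes_le _ _
  | handOver tag new old ph r =>
    simpa [handBound, HelpPc.atHandOver] using Slot.changes_pos hok.2
  | retry _ _ _ _ hx => simp [handBound, HelpPc.atHandOver, hx]
  | _ => simp [handBound, HelpPc.atHandOver]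

/-! ### The length of `help_thread` -/

/-- A bound for the number of steps that a helper still has to take, given bounds `l` and `w` for
the iterations of its two loops. -/
def helpRank (n l w : ℕ) : HelpPc → ℕ
  | .readResult => 4 * n + 14
  | .readEra _ => 4 * n + 13
  | .reserveParent _ _ => 4 * n + 12
  | .readPointer _ => 4 * n + 11
  | .readTag _ _ => 4 * n + 10
  | .readPrev _ _ => 4 * n + 9
  | .publish _ _ _ => 4 * l + 8
  | .load _ _ _ => 4 * l + 11
  | .readNew _ _ _ _ => 4 * l + 10
  | .recheck _ _ _ => 4 * l + 9
  | .produce _ _ _ => 8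
  | .readOld _ _ => 2 * w + 3
  | .handOver _ _ _ => 2 * w + 2
  | .clear2 => 2
  | .clear1 => 1

theorem helpRank_pos (n l w : ℕ) (h : HelpPc) : 0 < helpRank n l w h := by
  cases h <;> simp [helpRank]

theorem helpRank_mono {n l l' w w' : ℕ} (hl : l' ≤ l) (hw : w' ≤ w) (h : HelpPc) :
    helpRank n l' w' h ≤ helpRank n l w h := by
  cases h <;> simp only [helpRank] <;> omega

/-- An iteration of the helping loop takes at most four steps and one of the hand-over loop two. The
bound `l` drops on leaving `publish`, which is why `load` has a larger constant than `publish`. The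
value `8` at `produce` exceeds `2 * w + 3` because `w ≤ 2`. -/
theorem helpRank_move {x y : Slot} {g n l l' w w' : ℕ} {h h' : HelpPc}
    (hm : HelpMove g x y h (some h')) (hl : l' + h.atLoop ≤ l) (hw : w' + h.atHandOver ≤ w)
    (hln : l ≤ n) (hw2 : w ≤ 2) : helpRank n l' w' h' < helpRank n l w h := by
  cases hm <;> simp only [helpRank, HelpPc.atLoop, HelpPc.atHandOver] at * <;> omega

/-! ### Bounds in a configuration -/

noncomputable def Config.loopBound (c : Config p) (i : Fin p.threads) (j : Fin p.maxHes)
    (h : HelpPc) : ℕ :=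
  WFE.loopBound p.threads (c.slot i j) (c.staleCount i j) c.globalEra h

def Config.handBound (c : Config p) (i : Fin p.threads) (j : Fin p.maxHes) (h : HelpPc) : ℕ :=
  WFE.handBound (c.slot i j) h

structure BoundInv (c : Config p) : Prop extends Inv c where
  bounds : ∀ t caller i j rest h, c.pc t = .inc caller (.help i j rest h) →
    h.lastEra ≤ c.globalEra ∧ c.loopBound i j h ≤ p.threads ∧ c.handBound i j h ≤ 2

theorem Step.bounds_other {c c' : Config p} {u : Fin p.threads} (hs : Step c u c') (hc : Inv c)
    {i : Fin p.threads} {j : Fin p.maxHes} {h : HelpPc} (hok : (c.slot i j).HelpOK h) :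
    c'.loopBound i j h ≤ c.loopBound i j h ∧ c'.handBound i j h ≤ c.handBound i j h := by
  refine ⟨loopBound_later (hs.later hc i j) hok, handBound_later hok fun T hT => ?_⟩
  rcases slot_step hs i j with h | ⟨-, h⟩ | ⟨caller, rest, h, hpc, hm⟩
  · rw [h]
    exact ⟨le_rfl, fun h => (h rfl).elim⟩
  · exact h.changes (hc.good i j) hT
  · exact hm.changes (hc.helpOK _ _ _ _ _ _ hpc) hT

/-- A step of a thread in `help_thread` leaves it or makes progress. -/
theorem Step.help_progress {c c' : Config p} {t : Fin p.threads} (hs : Step c t c')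
    (hc : BoundInv c) {caller : Caller} {i : Fin p.threads} {j : Fin p.maxHes}
    {rest : List (Fin p.threads × Fin p.maxHes)} {h : HelpPc}
    (hpc : c.pc t = .inc caller (.help i j rest h)) :
    c'.pc t = .inc caller (.scan rest) ∨
      ∃ h', c'.pc t = .inc caller (.help i j rest h') ∧ h'.lastEra ≤ c'.globalEra ∧
        c'.loopBound i j h' + h.atLoop ≤ c.loopBound i j h ∧
        c'.handBound i j h' + h.atHandOver ≤ c.handBound i j h ∧
        helpRank p.threads (c'.loopBound i j h') (c'.handBound i j h') h' <
          helpRank p.threads (c.loopBound i j h) (c.handBound i j h) h := by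
  obtain ⟨hb1, hb2, hb3⟩ := hc.bounds _ _ _ _ _ _ hpc
  rcases hs.help_cases hc.mem with ⟨caller₁, i₁, j₁, rest₁, h₁, o, h2, hm, h4⟩ | ⟨hno, -⟩
  · rw [hpc] at h2
    simp only [Pc.inc.injEq, IncPc.help.injEq] at h2
    obtain ⟨rfl, rfl, rfl, rfl, rfl⟩ := h2
    cases o with
    | none => exact .inl h4
    | some h' =>
      have hera : c'.globalEra = c.globalEra := by
        rcases hs.frame.era with h | ⟨-, h⟩
        · exact h
        · rw [hpc] at h; exact h.elim
      have h4' : c'.pc t = .inc caller (.help i j rest h') := h4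
      have hl : c'.loopBound i j h' + h.atLoop ≤ c.loopBound i j h := by
        have hlater := hs.later hc.toInv i j
        rw [hera] at hlater
        rw [Config.loopBound, hera]
        refine loopBound_move hm hlater (hc.helpOK _ _ _ _ _ _ hpc) hb1 ?_ t.pos
        intro T hT
        refine c'.staleCount_lt (t := t) ?_
        rw [h4']
        exact fun hst => hst.2 ⟨rfl, hT⟩
      have hw : c'.handBound i j h' + h.atHandOver ≤ c.handBound i j h :=
        handBound_move hm (hc.helpOK _ _ _ _ _ _ hpc)
      exact .inr ⟨h', h4', hera ▸ hm.lastEra hb1, hl, hw, helpRank_move hm hl hw hb2 hb3⟩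
  · rw [hpc] at hno; cases hno

theorem BoundInv.step {c c' : Config p} {u : Fin p.threads} (hc : BoundInv c)
    (hs : Step c u c') : BoundInv c' := by
  refine ⟨hc.toInv.step hs, fun t caller i j rest h hpc => ?_⟩
  by_cases ht : t = u
  · subst ht
    rcases hs.help_cases hc.mem with ⟨caller₁, i₁, j₁, rest₁, h₁, o, h2, -, -⟩ | ⟨-, h2⟩
    · obtain ⟨hb1, hb2, hb3⟩ := hc.bounds _ _ _ _ _ _ h2
      rcases hs.help_progress hc h2 with h3 | ⟨h', h3, h4, h5, h6, -⟩ <;> rw [hpc] at h3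
      · simp at h3
      · simp only [Pc.inc.injEq, IncPc.help.injEq] at h3
        obtain ⟨rfl, rfl, rfl, rfl, rfl⟩ := h3
        exact ⟨h4, by omega, by omega⟩
    · obtain ⟨rfl, -⟩ := h2 _ _ _ _ _ hpc
      exact ⟨Nat.zero_le _, le_rfl, le_rfl⟩
  · rw [hs.frame.pc t ht] at hpc
    obtain ⟨hb1, hb2, hb3⟩ := hc.bounds _ _ _ _ _ _ hpc
    obtain ⟨h1, h2⟩ := hs.bounds_other hc.toInv (hc.helpOK _ _ _ _ _ _ hpc)
    exact ⟨hb1.trans (by rcases hs.frame.era with h | h <;> omega), h1.trans hb2, h2.trans hb3⟩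

theorem IsExecution.boundInv {c : ℕ → Config p} {σ : ℕ → Fin p.threads} (he : IsExecution c σ)
    (k : ℕ) : BoundInv (c k) := by
  induction k with
  | zero => exact ⟨he.init.inv, fun t _ _ _ _ _ hpc => by simp [he.init.pc] at hpc⟩
  | succ k ih => exact ih.step (he.step k)

/-! ### Counting iterations -/

/-- A potential argument on an interval outside of which nothing is known about `f`. The last step
may leave the interval, so its contribution is paid for by the positivity of `f` rather than by a
decrease. -/
theorem card_filter_Ico_le_of_decreasing (P : ℕ → Prop) [DecidablePred P] (f : ℕ → ℕ) (x n : ℕ)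
    (hP : ∀ k ∈ Finset.Ico x (x + n), P k → 0 < f k)
    (hf : ∀ k, x ≤ k → k + 1 < x + n → f (k + 1) + (if P k then 1 else 0) ≤ f k) (hn : 0 < n) :
    ((Finset.Ico x (x + n)).filter P).card ≤ f x := by
  induction n generalizing x with
  | zero => omega
  | succ n ih =>
    rw [show x + (n + 1) = (x + 1) + n by omega] at *
    rw [← Finset.insert_Ico_add_one_left_eq_Ico (by omega), Finset.filter_insert]
    have hins := Finset.card_insert_le x ((Finset.Ico (x + 1) (x + 1 + n)).filter P)
    rcases Nat.eq_zero_or_pos n with rfl | hn'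
    · split_ifs with hx
      · simpa [Nat.succ_le_iff] using hP x (by simp) hx
      · simp
    · have h1 := ih (x + 1) (fun k hk => hP k (by simp at hk ⊢; omega))
        (fun k hk => hf k (by omega)) hn'
      have h2 := hf x le_rfl (by omega)
      split_ifs at h2 ⊢ <;> omega

noncomputable def Config.loopBoundOf (c : Config p) (t : Fin p.threads) : ℕ :=
  match c.pc t with
  | .inc _ (.help i j _ h) => c.loopBound i j h
  | _ => 0

def Config.handBoundOf (c : Config p) (t : Fin p.threads) : ℕ :=
  match c.pc t with
  | .inc _ (.help i j _ h) => c.handBound i j h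
  | _ => 0

theorem Pc.exists_of_inHelp {q : Pc p} (h : q.inHelp = true) :
    ∃ caller i j rest h', q = .inc caller (.help i j rest h') := by
  unfold Pc.inHelp at h
  split at h
  · exact ⟨_, _, _, _, _, rfl⟩
  · cases h

theorem Step.boundsOf {c c' : Config p} {u t : Fin p.threads} (hs : Step c u c')
    (hc : BoundInv c) (h : (c.pc t).inHelp = true) (h' : (c'.pc t).inHelp = true) :
    c'.loopBoundOf t + (if u = t ∧ (c.pc t).atHelpLoop = true then 1 else 0) ≤ c.loopBoundOf t ∧
    c'.handBoundOf t + (if u = t ∧ (c.pc t).atHandOver = true then 1 else 0) ≤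
      c.handBoundOf t := by
  obtain ⟨caller, i, j, rest, g, hpc⟩ := Pc.exists_of_inHelp h
  by_cases hu : u = t
  · subst hu
    rcases hs.help_progress hc hpc with h1 | ⟨g', h1, -, h2, h3, -⟩
    · rw [h1] at h'; cases h'
    · simp only [Config.loopBoundOf, Config.handBoundOf, hpc, h1, true_and]
      constructor
      · cases g <;> simpa [Pc.atHelpLoop, HelpPc.atLoop] using h2
      · cases g <;> simpa [Pc.atHandOver, HelpPc.atHandOver] using h3
  · have h1 := hs.frame.pc t (Ne.symm hu)
    have h2 := hs.bounds_other hc.toInv (hc.helpOK _ _ _ _ _ _ hpc)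
    simp [Config.loopBoundOf, Config.handBoundOf, h1, hpc, hu, h2]

theorem perHelpCallBound_of (P : Pc p → Bool) (N : ℕ) (F : Config p → Fin p.threads → ℕ)
    (hstep : ∀ (c c' : Config p) (u t : Fin p.threads), Step c u c' → BoundInv c →
      (c.pc t).inHelp = true → (c'.pc t).inHelp = true →
        F c' t + (if u = t ∧ P (c.pc t) = true then 1 else 0) ≤ F c t)
    (hle : ∀ (c : Config p) t, BoundInv c → (c.pc t).inHelp = true → F c t ≤ N)
    (hpos : ∀ (c : Config p) t, BoundInv c → P (c.pc t) = true → 0 < F c t) :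
    PerHelpCallBound p P N := by
  intro c σ he t x y hin
  rcases Nat.lt_or_ge x y with hxy | hxy
  · obtain ⟨n, rfl⟩ := Nat.exists_eq_add_of_lt hxy
    refine (card_filter_Ico_le_of_decreasing _ (fun k => F (c k) t) x (n + 1) ?_ ?_
      (Nat.succ_pos n)).trans (hle _ t (he.boundInv x) (hin x (by simp)))
    · exact fun k _ hk => hpos _ t (he.boundInv k) hk.2
    · intro k hk hk'
      exact hstep _ _ _ t (he.step k) (he.boundInv k) (hin k (by simp; omega))
        (hin (k + 1) (by simp; omega))
  · simp [stepCountAt, Finset.Ico_eq_empty_of_le hxy]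

theorem perHelpCallBound_helpLoop (p : Params) :
    PerHelpCallBound p Pc.atHelpLoop p.threads := by
  refine perHelpCallBound_of _ _ Config.loopBoundOf
    (fun c c' u t hs hc h h' => (hs.boundsOf hc h h').1) ?_ ?_
  · intro c t hc h
    obtain ⟨caller, i, j, rest, g, hpc⟩ := Pc.exists_of_inHelp h
    simpa only [Config.loopBoundOf, hpc] using (hc.bounds _ _ _ _ _ _ hpc).2.1
  · intro c t hc h
    unfold Pc.atHelpLoop at h
    split at h
    next hpc =>
      simp only [Config.loopBoundOf, hpc, Config.loopBound, loopBound]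
      split_ifs <;> omega
    next => cases h

theorem perHelpCallBound_handOver (p : Params) : PerHelpCallBound p Pc.atHandOver 2 := by
  refine perHelpCallBound_of _ _ Config.handBoundOf
    (fun c c' u t hs hc h h' => (hs.boundsOf hc h h').2) ?_ ?_
  · intro c t hc h
    obtain ⟨caller, i, j, rest, g, hpc⟩ := Pc.exists_of_inHelp h
    simpa [Config.handBoundOf, hpc] using (hc.bounds _ _ _ _ _ _ hpc).2.2
  · intro c t hc h
    unfold Pc.atHandOver at h
    split at h
    next hpc =>
      have hok := hc.helpOK _ _ _ _ _ _ hpc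
      simp only [Config.handBoundOf, hpc, Config.handBound, handBound]
      split_ifs with hr
      · exact Slot.changes_pos (hr ▸ hok.2)
      · omega
    next => cases h

/-! ### `alloc_block` is wait-free -/

/-- A bound for the number of steps that thread `t` still has to take in `alloc_block`. -/
noncomputable def Config.allocRank (c : Config p) (t : Fin p.threads) : ℕ :=
  match c.pc t with
  | .allocEnter => (4 * p.threads + 15) * (p.threads * p.maxHes) + 8
  | .inc _ .readEnd => (4 * p.threads + 15) * (p.threads * p.maxHes) + 7
  | .inc _ (.readStart _) => (4 * p.threads + 15) * (p.threads * p.maxHes) + 6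
  | .inc _ (.scan todo) => (4 * p.threads + 15) * todo.length + 5
  | .inc _ (.help i j rest h) => (4 * p.threads + 15) * rest.length + 5 +
      helpRank p.threads (c.loopBound i j h) (c.handBound i j h) h
  | .inc _ .add => 4
  | .allocMalloc => 3
  | .allocEra _ => 2
  | .allocStore _ _ => 1
  | _ => 0

theorem length_allSlots (p : Params) : (allSlots p).length = p.threads * p.maxHes := by
  simp [allSlots]

theorem Config.allocRank_pos {c : Config p} {t : Fin p.threads} (h : (c.pc t).inAlloc = true) :
    0 < c.allocRank t := by
  unfold Config.allocRank
  cases hpc : c.pc t with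
  | inc caller q => cases q <;> simp
  | _ => simp_all [Pc.inAlloc]

theorem Step.eq_internalStep {c c' : Config p} {t : Fin p.threads} (hs : Step c t c')
    (h : (c.pc t).Internal) : c' = internalStep c t (c.pc t) := by
  cases hs with
  | internal => rfl
  | malloc h' => rw [h'] at h; exact h.elim
  | _ => simp_all [Pc.Internal]

/-- A step during a call of `alloc_block` returns a block, or continues the call. -/
theorem Step.alloc_progress {c c' : Config p} {u t : Fin p.threads} (hs : Step c u c')
    (hc : BoundInv c) (h : (c.pc t).inAlloc = true) :
    (∃ b, c'.pc t = .app (.blk b)) ∨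
      (c'.pc t).inAlloc = true ∧ c'.allocRank t + (if u = t then 1 else 0) ≤ c.allocRank t := by
  by_cases hu : u = t
  · subst hu
    cases hpc : c.pc u with
    | inc caller q =>
      cases caller with
      | retire => rw [hpc] at h; cases h
      | alloc =>
        right
        by_cases hq : ∃ i j rest g, q = .help i j rest g
        · obtain ⟨i, j, rest, g, rfl⟩ := hq
          rcases hs.help_progress hc hpc with h1 | ⟨g', h1, -, -, -, h2⟩
          · have := helpRank_pos p.threads (c.loopBound i j g) (c.handBound i j g) g
            simp only [Config.allocRank, hpc, h1, if_true]
            exact ⟨rfl, by omega⟩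
          · simp only [Config.allocRank, hpc, h1, if_true]
            exact ⟨rfl, by omega⟩
        · obtain rfl := (hpc ▸ hs.eq_internalStep (by rw [hpc]; trivial) :)
          cases q with
          | readEnd => simp [internalStep, incStep, Pc.inAlloc, Config.allocRank, hpc]
          | readStart ce =>
            simp only [internalStep, incStep]
            split_ifs <;>
              simp [Pc.inAlloc, Config.allocRank, hpc, length_allSlots]
          | scan todo =>
            cases todo with
            | nil => simp [internalStep, incStep, Pc.inAlloc, Config.allocRank, hpc]
            | cons s rest =>
              simp only [internalStep, incStep]
              -- Each list entry is worth `4n + 15`: this scan step and the `4n + 14` steps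
              -- available at `readResult`.
              split_ifs <;> simp [Pc.inAlloc, Config.allocRank, hpc, helpRank] <;> ring_nf <;> omega
          | help i j rest g => exact (hq ⟨i, j, rest, g, rfl⟩).elim
          | add => simp [internalStep, incStep, Pc.inAlloc, Config.allocRank, hpc, afterInc]
    | allocEnter =>
      right
      obtain rfl := (hpc ▸ hs.eq_internalStep (by rw [hpc]; trivial) :)
      simp only [internalStep]
      split_ifs <;> simp [Pc.inAlloc, Config.allocRank, hpc]
    | allocMalloc =>
      right
      cases hs with
      | malloc _ b hb => simp [Pc.inAlloc, Config.allocRank, hpc]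
      | internal h' => rw [hpc] at h'; exact h'.elim
      | _ => simp_all
    | allocEra b =>
      right
      obtain rfl := (hpc ▸ hs.eq_internalStep (by rw [hpc]; trivial) :)
      simp [internalStep, Pc.inAlloc, Config.allocRank, hpc]
    | allocStore b e =>
      left
      obtain rfl := (hpc ▸ hs.eq_internalStep (by rw [hpc]; trivial) :)
      exact ⟨b, by simp [internalStep]⟩
    | _ => rw [hpc] at h; cases h
  · right
    have h1 := hs.frame.pc t (Ne.symm hu)
    refine ⟨by rwa [h1], ?_⟩
    rw [if_neg hu, Nat.add_zero]
    simp only [Config.allocRank, h1]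
    split
    -- Inside `help_thread` the rank depends on shared memory; everywhere else it depends only on
    -- the thread's own control state.
    case h_5 caller i j rest g hpc =>
      have h2 := hs.bounds_other hc.toInv (hc.helpOK _ _ _ _ _ _ hpc)
      exact Nat.add_le_add_left (helpRank_mono h2.1 h2.2 g) _
    all_goals exact le_rfl

/-- Only the allocator's step has a precondition, and a fresh block always exists because finitely
many are in use. -/
theorem exists_step_of_inAlloc {c : Config p} {t : Fin p.threads}
    (h : (c.pc t).inAlloc = true) : ∃ c', Step c t c' := by
  by_cases hi : (c.pc t).Internal
  · exact ⟨_, .internal hi⟩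
  · have hpc : c.pc t = .allocMalloc := by
      revert h hi
      cases c.pc t <;> simp [Pc.inAlloc, Pc.Internal]
    obtain ⟨b, hb⟩ := Infinite.exists_notMem_finset c.allocated
    exact ⟨_, .malloc hpc b hb⟩

theorem stepCount_succ (σ : ℕ → Fin p.threads) (t : Fin p.threads) {x y : ℕ} (h : x ≤ y) :
    stepCount σ t x (y + 1) = stepCount σ t x y + if σ y = t then 1 else 0 := by
  unfold stepCount
  rw [← Finset.insert_Ico_right_eq_Ico_add_one h, Finset.filter_insert]
  split_ifs
  · rw [Finset.card_insert_of_notMem (by simp)]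
  · rfl

theorem allocWaitFreeBounded (p : Params) :
    AllocWaitFreeBounded p ((4 * p.threads + 15) * (p.threads * p.maxHes) + 8) := by
  intro c σ he
  refine ⟨fun t k => exists_step_of_inAlloc, fun t a ha b hb => ?_⟩
  by_contra hno
  -- As long as the call has not returned, the remaining rank plus the steps already taken stays
  -- within the initial rank.
  have key : ∀ n, a + 1 + n ≤ b →
      (∀ k ∈ Finset.Ioo a (a + 1 + n + 1), ((c k).pc t).inAlloc = true) ∧
      (c (a + 1 + n)).allocRank t + stepCount σ t (a + 1) (a + 1 + n) ≤
        (4 * p.threads + 15) * (p.threads * p.maxHes) + 8 := by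
    intro n
    induction n with
    | zero =>
      intro _
      refine ⟨fun k hk => ?_, by simp [stepCount, Config.allocRank, ha.2.2]⟩
      obtain rfl : k = a + 1 := by simp at hk; omega
      rw [ha.2.2]; rfl
    | succ n ih =>
      intro hn
      obtain ⟨h1, h2⟩ := ih (by omega)
      rcases (he.step (a + 1 + n)).alloc_progress (he.boundInv _) (h1 _ (by simp; omega)) with
        h3 | ⟨h3, h4⟩
      · exact (hno ⟨a + 1 + n + 1, by omega, by omega, h1, h3⟩).elim
      · refine ⟨fun k hk => ?_, ?_⟩
        · rcases Nat.lt_or_ge k (a + 1 + n + 1) with hk' | hk'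
          · exact h1 k (by simp at hk ⊢; omega)
          · obtain rfl : k = a + 1 + n + 1 := by simp at hk; omega
            exact h3
        · have := stepCount_succ σ t (show a + 1 ≤ a + 1 + n by omega)
          rw [← Nat.add_assoc (a + 1) n 1]
          omega
  have hab : a + 1 ≤ b := by
    by_contra hlt
    simp [stepCount, Finset.Ico_eq_empty_of_le (show b ≤ a + 1 by omega)] at hb
  obtain ⟨n, rfl⟩ := Nat.exists_eq_add_of_le hab
  obtain ⟨h1, h2⟩ := key n le_rfl
  -- At time `b` the call is still running, so its rank is positive and fewer steps than the bound
  -- have been taken.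
  have := Config.allocRank_pos (h1 (a + 1 + n) (by simp; omega))
  omega

end WFE

theorem mainTheorem2 :
    ∃ B : ℕ → ℕ → ℕ, ∀ p : WFE.Params,
      WFE.AllocWaitFreeBounded p (B p.threads p.maxHes) ∧
      WFE.PerHelpCallBound p WFE.Pc.atHelpLoop p.threads ∧
      WFE.PerHelpCallBound p WFE.Pc.atHandOver 2 :=
  ⟨fun n m => (4 * n + 15) * (n * m) + 8, fun p => ⟨WFE.allocWaitFreeBounded p,
    WFE.perHelpCallBound_helpLoop p, WFE.perHelpCallBound_handOver p⟩⟩
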